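/- Let $n \ge 2$ and $0 < T \le \sqrt{2\pi}$. Let $\gamma^k$ denote the standard Gaussian probability measure on $\mathbb{R}^k$ and $\varphi_\gamma(s) = (2\pi)^{-1/2} e^{-s^2/2}$, $\Phi_\gamma(s) = \int_{-\infty}^s \varphi_\gamma(x)\,dx$. For a closed set $M \subseteq \mathbb{R}^k$ carrying a probability measure $\mu$ which has on $M$ a smooth positive density $\Psi$ with respect to Lebesgue measure, define the weighted perimeter of a Borel set $E \subseteq M$ by \[ A(E) = \sup\Big\{ \int_E \mathrm{div}(\Psi X)\, dx \;:\; X \in C^1_c(\mathrm{int}\, M ; \mathbb{R}^k),\ |X| \le 1 \Big\} \in [0,\infty] \] (equivalently, $A(E) = \int_{\partial^* E \cap \mathrm{int}\, M} \Psi \, d\mathcal{H}^{k-1}$, with $\partial^* E$ the reduced boundary, if $E$ has locally finite perimeter in $\mathrm{int}\,M$, and $A(E) = \infty$ otherwise), and the isoperimetric profile of $(M,\mu)$ by $\mathcal{I}(\bar v) = \inf\{ A(E) : E \subseteq M \text{ Borel},\ \mu(E) = \bar v\}$ for $\bar v \in [0,1]$. A Borel set $E \subseteq M$ with $\mu(E)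 = \bar v$ and $A(E) = \mathcal{I}(\bar v)$ is called an isoperimetric minimizer of weighted volume $\bar v$. Let $\mathcal{I}_T$ be the isoperimetric profile of the Gaussian slab $\mathbf{G}^n_T = [0,T] \times \mathbb{R}^{n-1}$ with the measure $\mu_T = \frac{1}{T}\,\mathfrak{m}\llcorner_{[0,T]} \otimes \gamma^{n-1}$ ($\mathfrak{m}$ being Lebesgue measure), and let $\mathcal{I}_\gamma$ be the isoperimetric profile of $(\mathbb{R}, \gamma^1)$. Then $\mathcal{I}_T(\bar v) = \mathcal{I}_\gamma(\bar v)$ for all $\bar v \in [0,1]$. Moreover, for every $\bar v \in (0,1)$, the horizontal half-space $\{ x \in [0,T]\times\mathbb{R}^{n-1} : x_n \le \Phi_\gamma^{-1}(\bar v)\}$ is an isoperimetric minimizer of weighted volume $\bar v$ in $\mathbf{G}^n_T$, and $\mathcal{I}_\gamma(\bar v) = \varphi_\gamma(\Phi_\gamma^{-1}(\bar v))$. -/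

import Mathlib

open MeasureTheory ProbabilityTheory Set
open scoped ENNReal

noncomputable section

namespace GaussianSlab

/-! ### Weighted perimeter and isoperimetric profile

A weighted domain consists of a set `M` in a Euclidean space `F` (equal to the closure of its
interior in the cases below), a measure `μ` on `F` carried by `M`, and the smooth density `Ψ` of
`μ` on `M` with respect to Lebesgue measure. -/

section Perimeter

variable {F : Type*} [NormedAddCommGroup F] [InnerProductSpace ℝ F] [FiniteDimensional ℝ F]

/-- The divergence of a vector field, i.e. the trace of its derivative. -/
def divergence (X : F → F) (x : F) : ℝ :=
  LinearMap.trace ℝ F (fderiv ℝ X x : F →ₗ[ℝ] F)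

/-- The admissible test fields for the perimeter in an open set `U`: vector fields of class `C¹`,
compactly supported in `U`, of length at most one everywhere. -/
def testFields (U : Set F) : Set (F → F) :=
  {X | ContDiff ℝ 1 X ∧ HasCompactSupport X ∧ tsupport X ⊆ U ∧ ∀ x, ‖X x‖ ≤ 1}

variable [MeasureSpace F]

/-- The perimeter `A(E)` of `E` in the interior of `M`, weighted by the density `Ψ`, in the sense
of De Giorgi: the supremum of `∫_E div (Ψ X)` over all test fields `X` in the interior of `M`.
For a positive smooth `Ψ` it is the integral of `Ψ` over `interior M` against the total variation
of the distributional gradient of the indicator function of `E` (that is, against the Hausdorff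
measure of codimension one on the reduced boundary of `E`) if `E` has locally finite perimeter,
and it is `∞` if it does not. The boundary of `M` does not contribute. -/
def weightedPerimeter (M : Set F) (Ψ : F → ℝ) (E : Set F) : ℝ≥0∞ :=
  ⨆ X ∈ testFields (interior M),
    ENNReal.ofReal (∫ x in E, divergence (fun y => Ψ y • X y) x)

/-- The isoperimetric profile: the infimum of the weighted perimeters of the Borel
subsets of `M` of weighted volume `v`. -/
def isoperimetricProfile (M : Set F) (μ : Measure F) (Ψ : F → ℝ) (v : ℝ) : ℝ≥0∞ :=
  ⨅ (E : Set F) (_ : MeasurableSet E ∧ E ⊆ M ∧ μ E = ENNReal.ofReal v), weightedPerimeter M Ψ E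

/-- `E` is an isoperimetric minimizer of weighted volume `v`. -/
def IsIsoperimetricMinimizer (M : Set F) (μ : Measure F) (Ψ : F → ℝ) (v : ℝ) (E : Set F) : Prop :=
  MeasurableSet E ∧ E ⊆ M ∧ μ E = ENNReal.ofReal v ∧
    weightedPerimeter M Ψ E = isoperimetricProfile M μ Ψ v

end Perimeter

/-! ### The Gaussian line -/

/-- The isoperimetric profile `I_γ` of the real line with the standard Gaussian measure. -/
def gaussianProfile (v : ℝ) : ℝ≥0∞ :=
  isoperimetricProfile (univ : Set ℝ) (gaussianReal 0 1) (gaussianPDFReal 0 1) v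

/-- The inverse of the standard Gaussian distribution function `Φ_γ` (a bijection from
the real line onto `(0, 1)`). -/
def gaussianQuantile (v : ℝ) : ℝ :=
  Function.invFun (fun s => cdf (gaussianReal 0 1) s) v

/-! ### The Gaussian slab

The slab of width `T` over the Gaussian base of dimension `m` lives in a Euclidean space of
dimension `m + 1`; the coordinate `x 0` is the horizontal one. -/

/-- The slab `[0, T] × ℝᵐ`. -/
def slab (m : ℕ) (T : ℝ) : Set (EuclideanSpace ℝ (Fin (m + 1))) :=
  {x | x 0 ∈ Icc 0 T}

/-- The probability measure on the slab: the product of the uniform probability measure on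
`[0, T]` and of the standard Gaussian measure on `ℝᵐ`. -/
def slabMeasure (m : ℕ) (T : ℝ) : Measure (EuclideanSpace ℝ (Fin (m + 1))) :=
  (((ENNReal.ofReal T)⁻¹ • (volume : Measure ℝ).restrict (Icc 0 T)).prod
    (stdGaussian (EuclideanSpace ℝ (Fin m)))).map
      (fun p => WithLp.toLp 2 (Fin.cons p.1 (fun i => p.2 i) : Fin (m + 1) → ℝ))

/-- The density of `slabMeasure m T` on the slab, see `slabMeasure_eq_withDensity`. -/
def slabDensity (m : ℕ) (T : ℝ) (x : EuclideanSpace ℝ (Fin (m + 1))) : ℝ :=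
  T⁻¹ * ∏ i : Fin m, gaussianPDFReal 0 1 (x i.succ)

/-- The horizontal half-space `{x_n ≤ s}` in the slab, `x_n` being the last coordinate. -/
def horizontalHalfSpace (m : ℕ) (T s : ℝ) : Set (EuclideanSpace ℝ (Fin (m + 1))) :=
  {x ∈ slab m T | x (Fin.last m) ≤ s}

/-- A product of measures on the line with densities has the product density. -/
lemma pi_withDensity_eq (m : ℕ) (f : Fin m → ℝ → ℝ≥0∞) (hf : ∀ i, Measurable (f i))
    [∀ i, SigmaFinite ((volume : Measure ℝ).withDensity (f i))] :
    Measure.pi (fun i => (volume : Measure ℝ).withDensity (f i)) =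
      (volume : Measure (Fin m → ℝ)).withDensity (fun x => ∏ i, f i (x i)) := by
  induction m with
  | zero =>
    simp only [Finset.univ_eq_empty, Finset.prod_empty]
    change _ = volume.withDensity 1
    rw [withDensity_one, volume_pi, Measure.pi_of_empty, Measure.pi_of_empty]
  | succ k ih =>
    have h1 := (measurePreserving_piFinSuccAbove
      (fun i => (volume : Measure ℝ).withDensity (f i)) 0).symm
    have h2 := (volume_preserving_piFinSuccAbove (fun _ : Fin (k + 1) => ℝ) 0).symm
    have : ∀ i : Fin k, SigmaFinite ((volume : Measure ℝ).withDensity (f (Fin.succAbove 0 i))) :=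
      fun i => inferInstance
    have h3 := ih (fun i => f (Fin.succAbove 0 i)) (fun i => hf _)
    rw [← h1.map_eq]
    have : SFinite ((volume : Measure ℝ).withDensity (f 0)) := inferInstance
    erw [h3]
    rw [prod_withDensity (hf 0) (by fun_prop)]
    ext s hs
    rw [Measure.map_apply (MeasurableEquiv.measurable _) hs, withDensity_apply _ hs,
      withDensity_apply _ (MeasurableEquiv.measurable _ hs),
      ← h2.setLIntegral_comp_preimage_emb (MeasurableEquiv.measurableEmbedding _)]
    refine setLIntegral_congr_fun (MeasurableEquiv.measurable _ hs) (fun p _ => ?_)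
    simp [Fin.prod_univ_succ, MeasurableEquiv.piFinSuccAbove_symm_apply]

/-- `slabDensity` is the density of `slabMeasure` with respect to Lebesgue measure on the slab. -/
theorem slabMeasure_eq_withDensity (m : ℕ) {T : ℝ} (hT : 0 < T) :
    slabMeasure m T =
      (volume.restrict (slab m T)).withDensity (fun x => ENNReal.ofReal (slabDensity m T x)) := by
  let f : Fin (m + 1) → ℝ → ℝ≥0∞ :=
    Fin.cons ((Icc 0 T).indicator (fun _ => (ENNReal.ofReal T)⁻¹)) (fun _ => gaussianPDF 0 1)
  have hf : ∀ i, Measurable (f i) := by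
    intro i
    refine Fin.cases ?_ (fun j => ?_) i
    · exact measurable_const.indicator measurableSet_Icc
    · exact measurable_gaussianPDF 0 1
  have e0 : (volume : Measure ℝ).withDensity (f 0) =
      (ENNReal.ofReal T)⁻¹ • (volume : Measure ℝ).restrict (Icc 0 T) := by
    simp only [f, Fin.cons_zero]
    rw [withDensity_indicator measurableSet_Icc, withDensity_const]
  have e1 : ∀ i : Fin m, (volume : Measure ℝ).withDensity (f i.succ) = gaussianReal 0 1 := by
    intro i
    simp only [f, Fin.cons_succ]
    rw [gaussianReal_of_var_ne_zero _ one_ne_zero]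
  have hTne : (ENNReal.ofReal T)⁻¹ ≠ ∞ := by simp [hT]
  have : IsFiniteMeasure ((ENNReal.ofReal T)⁻¹ • (volume : Measure ℝ).restrict (Icc 0 T)) :=
    Measure.smul_finite _ hTne
  have hs : ∀ i, SigmaFinite ((volume : Measure ℝ).withDensity (f i)) := by
    intro i
    refine Fin.cases ?_ (fun j => ?_) i
    · rw [e0]; infer_instance
    · rw [e1]; infer_instance
  have key := pi_withDensity_eq (m + 1) f hf
  have hprod := (measurePreserving_piFinSuccAbove
      (fun i => (volume : Measure ℝ).withDensity (f i)) 0).symm.map_eq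
  have htail : (fun j : Fin m => (volume : Measure ℝ).withDensity (f (Fin.succAbove 0 j))) =
      fun _ => gaussianReal 0 1 := by
    funext j; simpa using e1 j
  rw [key, htail, e0] at hprod
  have hvol := PiLp.volume_preserving_toLp (Fin (m + 1))
  have hemb : MeasurableEmbedding (WithLp.toLp 2 : (Fin (m + 1) → ℝ) → _) :=
    (MeasurableEquiv.toLp 2 (Fin (m + 1) → ℝ)).measurableEmbedding
  have hslab : MeasurableSet (slab m T) := by
    have : Measurable (fun x : EuclideanSpace ℝ (Fin (m + 1)) => x 0) := by fun_prop
    exact this measurableSet_Icc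
  have hL : slabMeasure m T =
      ((volume : Measure (Fin (m + 1) → ℝ)).withDensity (fun x => ∏ i, f i (x i))).map
        (WithLp.toLp 2) := by
    rw [← hprod, Measure.map_map (by fun_prop) (MeasurableEquiv.measurable _), slabMeasure,
      ← map_pi_eq_stdGaussian]
    have hm : (((ENNReal.ofReal T)⁻¹ • (volume : Measure ℝ).restrict (Icc 0 T)).prod
        ((Measure.pi (fun _ : Fin m => gaussianReal 0 1)).map (WithLp.toLp 2))) =
        (((ENNReal.ofReal T)⁻¹ • (volume : Measure ℝ).restrict (Icc 0 T)).prod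
        (Measure.pi (fun _ : Fin m => gaussianReal 0 1))).map (Prod.map id (WithLp.toLp 2)) := by
      rw [← Measure.map_prod_map _ _ measurable_id (by fun_prop), Measure.map_id]
    rw [hm, Measure.map_map ?_ (by fun_prop)]
    · congr 1
      funext p
      simp [MeasurableEquiv.piFinSuccAbove_symm_apply, Fin.insertNthEquiv]
    · refine (WithLp.measurable_toLp 2 _).comp (measurable_pi_lambda _ fun i => ?_)
      refine Fin.cases ?_ (fun j => ?_) i
      · simpa using measurable_fst
      · simp only [Fin.cons_succ]
        fun_prop
  rw [hL, ← withDensity_indicator hslab]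
  ext s hs
  rw [Measure.map_apply (by fun_prop) hs, withDensity_apply _ hs,
    withDensity_apply _ ((WithLp.measurable_toLp 2 _) hs),
    ← hvol.setLIntegral_comp_preimage_emb hemb]
  refine setLIntegral_congr_fun ((WithLp.measurable_toLp 2 _) hs) (fun x _ => ?_)
  by_cases hx : x 0 ∈ Icc 0 T
  · have : WithLp.toLp 2 x ∈ slab m T := hx
    rw [Set.indicator_of_mem this, Fin.prod_univ_succ]
    simp only [f, Fin.cons_zero, Fin.cons_succ, Set.indicator_of_mem hx, slabDensity, gaussianPDF]
    rw [ENNReal.ofReal_mul (inv_nonneg.2 hT.le), ENNReal.ofReal_inv_of_pos hT,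
      ENNReal.ofReal_prod_of_nonneg (fun i _ => gaussianPDFReal_nonneg 0 1 _)]
  · have : WithLp.toLp 2 x ∉ slab m T := hx
    rw [Set.indicator_of_notMem this, Fin.prod_univ_succ]
    simp [f, Set.indicator_of_notMem hx]

end GaussianSlab
end

noncomputable section

namespace GaussianSlab

open Filter Topology

local notation "φ₁" => gaussianPDFReal 0 1
local notation "Φ₁" => cdf (gaussianReal 0 1)

/-! ### The Gaussian distribution function -/

/-! The lower bound for the slab comes from Gauss space. Let `slabMap` send the coordinate `x 0` to
`T * Φ(x 0)` and fix the others. It carries the standard Gaussian measure of dimension `m + 1` to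
the measure of the slab (`map_slabMap`), and since `T φ ≤ T / √(2π) ≤ 1` it does not increase
lengths. Pushing a test field of Gauss space forward by the differential of this map gives a test
field of the slab (`pushField_mem_testFields`) with the same weighted divergence at corresponding
points (`divergence_pushField_slabMap`). Hence a set in the slab has at least the perimeter of its
preimage (`weightedPerimeter_preimage_le`), which has the same volume, and the Gaussian
isoperimetric inequality bounds that perimeter below by `I(v) = φ(Φ⁻¹(v))`. Half-spaces attain this
bound in the slab and on the line (`weightedPerimeter_halfSpace_le`): smooth the indicator function
and apply the divergence theorem.

The Gaussian isoperimetric inequality (`IsGaussianDensity.isoperimetric`) is proved with the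
Ornstein-Uhlenbeck operators `P_θ f(x) = ∫ f(cos θ x + sin θ y) dγ(y)`, which run from the identity
at `θ = 0` to the mean at `θ = π/2`. Let `J(θ) = ∫ I(P_θ 1_E) dγ`. Then `J(π/2) = I(γ(E))`, while
`J(θ) → 0` as `θ → 0`, because `I` vanishes at 0 and 1. It remains to see that `J` grows in total by
at most the perimeter `A` of `E`.

Put `h_a = Φ⁻¹(P_a 1_E)`. Since `I` is concave with derivative `-Φ⁻¹`, and `P_θ` is symmetric, `J(b)
- J(a) ≤ -∫_E (P_b h_a - P_a h_a) dγ`. Two facts bound the right side. First, `h_a` is Lipschitz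
with constant `cot a` (`quantile_mehler_le`), because half-spaces gain the most mass under
translation. Second, for an `L`-Lipschitz `C¹` function `g` the increment `P_b g - P_a g` is the
Gaussian divergence of an explicit field of length at most `L (cos a - cos b)`
(`divergence_mehlerField_sub`, `norm_mehlerField_le`), so its integral over `E` is at most that
length times `A`; mollification extends this to all Lipschitz `g`. Thus `J(b) - J(a) ≤ A cot a (cos
a - cos b)`, and these increments add up to at most `A ∫ cos = A` in the limit of fine partitions of
`(0, π/2]`. -/

lemma stdPDF_eq (s : ℝ) : φ₁ s = (√(2 * Real.pi))⁻¹ * Real.exp (-(s ^ 2) / 2) := by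
  simp [gaussianPDFReal]

lemma stdPDF_pos (s : ℝ) : 0 < φ₁ s := gaussianPDFReal_pos 0 1 s one_ne_zero

lemma hasDerivAt_stdPDF (s : ℝ) : HasDerivAt φ₁ (-s * φ₁ s) s := by
  have e : φ₁ = fun s => (√(2 * Real.pi))⁻¹ * Real.exp (-(s ^ 2) / 2) := funext stdPDF_eq
  rw [e]
  have := (((((hasDerivAt_id s).pow 2).neg).div_const 2).exp).const_mul ((√(2 * Real.pi))⁻¹)
  refine this.congr_deriv ?_
  simp only [Pi.neg_apply, Pi.pow_apply, id]
  push_cast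
  ring

lemma contDiff_stdPDF {n : WithTop ℕ∞} : ContDiff ℝ n φ₁ := by
  have e : φ₁ = fun s => (√(2 * Real.pi))⁻¹ * Real.exp (-(s ^ 2) / 2) := funext stdPDF_eq
  rw [e]
  fun_prop

lemma continuous_stdPDF : Continuous φ₁ := contDiff_stdPDF (n := 0).continuous

lemma stdPDF_le (s : ℝ) : φ₁ s ≤ (√(2 * Real.pi))⁻¹ := by
  rw [stdPDF_eq]
  refine mul_le_of_le_one_right (by positivity) (Real.exp_le_one_iff.2 ?_)
  nlinarith [sq_nonneg s]

lemma stdCDF_sub (a b : ℝ) : Φ₁ b - Φ₁ a = ∫ x in a..b, φ₁ x := by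
  have h : ∀ s, Φ₁ s = ∫ x in Iic s, φ₁ x := fun s => by
    rw [cdf_eq_real, Measure.real, gaussianReal_apply_eq_integral 0 one_ne_zero,
      ENNReal.toReal_ofReal (integral_nonneg fun _ => gaussianPDFReal_nonneg _ _ _)]
  rw [h, h, intervalIntegral.integral_Iic_sub_Iic] <;>
  exact (integrable_gaussianPDFReal 0 1).integrableOn

lemma hasDerivAt_stdCDF (s : ℝ) : HasDerivAt Φ₁ (φ₁ s) s := by
  have e : ∀ b, Φ₁ b = Φ₁ 0 + ∫ x in (0 : ℝ)..b, φ₁ x := fun b => by rw [← stdCDF_sub]; ring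
  have := (intervalIntegral.integral_hasDerivAt_right
    (continuous_stdPDF.intervalIntegrable 0 s)
    (continuous_stdPDF.stronglyMeasurableAtFilter _ _) continuous_stdPDF.continuousAt).const_add (Φ₁ 0)
  exact this.congr_of_eventuallyEq (Eventually.of_forall e)

lemma continuous_stdCDF : Continuous Φ₁ :=
  continuous_iff_continuousAt.2 fun s => (hasDerivAt_stdCDF s).continuousAt

lemma strictMono_stdCDF : StrictMono Φ₁ :=
  strictMono_of_deriv_pos fun s => by rw [(hasDerivAt_stdCDF s).deriv]; exact stdPDF_pos s

lemma stdCDF_pos (s : ℝ) : 0 < Φ₁ s :=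
  (cdf_nonneg _ (s - 1)).trans_lt (strictMono_stdCDF (by linarith))

lemma stdCDF_lt_one (s : ℝ) : Φ₁ s < 1 :=
  (strictMono_stdCDF (by linarith : s < s + 1)).trans_le (cdf_le_one _ _)

lemma stdCDF_quantile {v : ℝ} (hv : v ∈ Ioo (0 : ℝ) 1) : Φ₁ (gaussianQuantile v) = v := by
  apply Function.invFun_eq (f := fun s => Φ₁ s)
  have h0 := (tendsto_cdf_atBot (gaussianReal 0 1)).eventually (gt_mem_nhds hv.1)
  have h1 := (tendsto_cdf_atTop (gaussianReal 0 1)).eventually (lt_mem_nhds hv.2)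
  obtain ⟨a, ha⟩ := h0.exists
  obtain ⟨b, hb⟩ := h1.exists
  exact mem_range_of_exists_le_of_exists_ge continuous_stdCDF ⟨a, ha.le⟩ ⟨b, hb.le⟩

lemma quantile_stdCDF (s : ℝ) : gaussianQuantile (Φ₁ s) = s :=
  Function.leftInverse_invFun (f := fun s => Φ₁ s) strictMono_stdCDF.injective s

lemma hasDerivAt_quantile {v : ℝ} (hv : v ∈ Ioo (0 : ℝ) 1) :
    HasDerivAt gaussianQuantile (φ₁ (gaussianQuantile v))⁻¹ v := by
  -- A strictly increasing function on `(0, 1)` whose image is the whole line has no jumps.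
  have hc : ContinuousAt gaussianQuantile v := by
    have hm : StrictMonoOn gaussianQuantile (Ioo 0 1) := fun a ha b hb hab => by
      rw [← stdCDF_quantile ha, ← stdCDF_quantile hb] at hab
      exact strictMono_stdCDF.lt_iff_lt.1 hab
    refine hm.continuousAt_of_image_mem_nhds (isOpen_Ioo.mem_nhds hv) ?_
    refine mem_of_superset univ_mem fun s _ => ?_
    exact ⟨Φ₁ s, ⟨stdCDF_pos s, stdCDF_lt_one s⟩, quantile_stdCDF s⟩
  refine HasDerivAt.of_local_left_inverse hc (hasDerivAt_stdCDF _) (stdPDF_pos _).ne' ?_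
  filter_upwards [isOpen_Ioo.mem_nhds hv] with w hw using stdCDF_quantile hw

lemma contDiffOn_quantile : ContDiffOn ℝ 1 gaussianQuantile (Ioo 0 1) := by
  rw [show (1 : WithTop ℕ∞) = 0 + 1 from (zero_add _).symm,
    contDiffOn_succ_iff_deriv_of_isOpen isOpen_Ioo]
  refine ⟨fun v hv => (hasDerivAt_quantile hv).differentiableAt.differentiableWithinAt,
    by simp, contDiffOn_zero.2 ?_⟩
  have h : ContinuousOn (fun v => (φ₁ (gaussianQuantile v))⁻¹) (Ioo 0 1) :=
    (continuous_stdPDF.comp_continuousOn fun v hv =>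
      (hasDerivAt_quantile hv).continuousAt.continuousWithinAt).inv₀ fun v _ => (stdPDF_pos _).ne'
  exact h.congr fun v hv => (hasDerivAt_quantile hv).deriv

/-- Concavity of the profile `φ ∘ Φ⁻¹`. -/
lemma stdPDF_le_tangent (s t : ℝ) : φ₁ s ≤ φ₁ t - t * (Φ₁ s - Φ₁ t) := by
  -- The gap between tangent and profile, written in the variable `s = Φ⁻¹(u)`. Its derivative `(s -
  -- t) φ(s)` changes sign only at `t`, so `t` is a global minimum, with value 0.
  set f : ℝ → ℝ := fun s => φ₁ t - t * (Φ₁ s - Φ₁ t) - φ₁ s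
  have hf : ∀ s, HasDerivAt f ((s - t) * φ₁ s) s := fun s => by
    have := ((((hasDerivAt_stdCDF s).sub_const (Φ₁ t)).const_mul t).const_sub (φ₁ t)).sub
      (hasDerivAt_stdPDF s)
    exact this.congr_deriv (by ring)
  have hc : Continuous f := continuous_iff_continuousAt.2 fun s => (hf s).continuousAt
  have ht : f t = 0 := by simp [f]
  suffices f t ≤ f s by rw [ht] at this; simp only [f] at this; linarith
  rcases le_total t s with h | h
  · refine monotoneOn_of_deriv_nonneg (convex_Ici t) hc.continuousOn
      (fun x _ => (hf x).differentiableAt.differentiableWithinAt) (fun x hx => ?_) self_mem_Ici h h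
    rw [interior_Ici] at hx
    rw [(hf x).deriv]
    exact mul_nonneg (sub_nonneg.2 (le_of_lt hx)) (stdPDF_pos x).le
  · refine antitoneOn_of_deriv_nonpos (convex_Iic t) hc.continuousOn
      (fun x _ => (hf x).differentiableAt.differentiableWithinAt) (fun x hx => ?_) h self_mem_Iic h
    rw [interior_Iic] at hx
    rw [(hf x).deriv]
    exact mul_nonpos_of_nonpos_of_nonneg (sub_nonpos.2 (le_of_lt hx)) (stdPDF_pos x).le

/-- Off a compact set `φ` is below `ε`, and on it the continuous quotient `φ / (Φ (1 - Φ))` is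
bounded. With `u = Φ(s)` this reads `I(u) ≤ ε + K u (1 - u)`, which forces `J(θ)` to vanish at small
angles. -/
lemma exists_stdPDF_le {ε : ℝ} (hε : 0 < ε) :
    ∃ K, 0 ≤ K ∧ ∀ s, φ₁ s ≤ ε + K * (Φ₁ s * (1 - Φ₁ s)) := by
  have hnn : ∀ s, 0 < Φ₁ s * (1 - Φ₁ s) := fun s =>
    mul_pos (stdCDF_pos s) (sub_pos.2 (stdCDF_lt_one s))
  have hlim : Tendsto φ₁ (cocompact ℝ) (𝓝 0) := by
    have e : φ₁ = fun s => (√(2 * Real.pi))⁻¹ * Real.exp (-(s ^ 2) / 2) := funext stdPDF_eq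
    rw [e, ← mul_zero ((√(2 * Real.pi))⁻¹)]
    refine Tendsto.const_mul _ (Real.tendsto_exp_atBot.comp ?_)
    have h2 : Tendsto (fun s : ℝ => |s| ^ 2 / 2) (cocompact ℝ) atTop :=
      ((tendsto_pow_atTop two_ne_zero).comp (tendsto_norm_cocompact_atTop (E := ℝ))).atTop_div_const
        two_pos
    refine (tendsto_neg_atTop_atBot.comp h2).congr fun s => ?_
    simp [neg_div]
  obtain ⟨S, hS, hS'⟩ := mem_cocompact.1 (hlim.eventually (gt_mem_nhds hε))
  have hcont : Continuous fun s => φ₁ s / (Φ₁ s * (1 - Φ₁ s)) :=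
    continuous_stdPDF.div (continuous_stdCDF.mul (continuous_const.sub continuous_stdCDF))
      fun s => (hnn s).ne'
  obtain ⟨K, hK⟩ := (hS.image hcont).bddAbove
  refine ⟨max K 0, le_max_right _ _, fun s => ?_⟩
  by_cases hs : s ∈ S
  · have h1 := hK (mem_image_of_mem _ hs)
    rw [div_le_iff₀ (hnn s)] at h1
    have := mul_le_mul_of_nonneg_right (le_max_left K 0) (hnn s).le
    linarith
  · have h1 : φ₁ s < ε := hS' hs
    have := mul_nonneg (le_max_right K 0) (hnn s).le
    linarith

/-! ### Gaussian spaces -/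

section GaussianSpace

variable {F : Type*} [NormedAddCommGroup F] [InnerProductSpace ℝ F] [FiniteDimensional ℝ F]

section Measurable

variable [MeasurableSpace F] [BorelSpace F]

lemma stdGaussian_map_inner {e : F} (he : ‖e‖ = 1) :
    (stdGaussian F).map (fun z => inner ℝ e z) = gaussianReal 0 1 := by
  have h := IsGaussian.map_eq_gaussianReal (μ := stdGaussian F) (innerSL ℝ e)
  rw [integral_strongDual_stdGaussian, variance_dual_stdGaussian, innerSL_apply_norm, he] at h
  simpa using h

lemma stdGaussian_map_neg : (stdGaussian F).map (fun z => -z) = stdGaussian F :=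
  stdGaussian_map (LinearIsometryEquiv.neg ℝ (E := F))

lemma integral_stdGaussian_neg (f : F → ℝ) :
    ∫ y, f (-y) ∂stdGaussian F = ∫ y, f y ∂stdGaussian F := by
  conv_rhs => rw [← stdGaussian_map_neg]
  exact ((MeasurableEquiv.neg F).measurableEmbedding.integral_map f).symm

lemma stdGaussian_prod_map_rotation (θ : ℝ) :
    ((stdGaussian F).prod (stdGaussian F)).map (ContinuousLinearMap.rotation θ) =
      (stdGaussian F).prod (stdGaussian F) :=
  IsGaussian.map_rotation_eq_self_of_forall_strongDual_eq_zero integral_strongDual_stdGaussian θ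

lemma integrable_norm_stdGaussian : Integrable (fun y : F => ‖y‖) (stdGaussian F) := by
  have h := IsGaussian.memLp_id (stdGaussian F) 1 (by simp)
  exact (memLp_one_iff_integrable.1 h).norm

/-- The Ornstein-Uhlenbeck (Mehler) operator, parametrised by an angle. -/
def mehler (θ : ℝ) (f : F → ℝ) (x : F) : ℝ :=
  ∫ y, f (Real.cos θ • x + Real.sin θ • y) ∂stdGaussian F

lemma integrable_of_mem_Icc {α : Type*} [MeasurableSpace α] {μ : Measure α} [IsFiniteMeasure μ]
    {f : α → ℝ} (hf : Measurable f) (h : ∀ x, f x ∈ Icc (0 : ℝ) 1) : Integrable f μ :=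
  Integrable.of_bound hf.aestronglyMeasurable 1 (Eventually.of_forall fun x => by
    rw [Real.norm_of_nonneg (h x).1]; exact (h x).2)

lemma measurable_mehler {f : F → ℝ} (hf : Measurable f) (θ : ℝ) : Measurable (mehler θ f) := by
  have h : Measurable fun p : F × F => f (Real.cos θ • p.1 + Real.sin θ • p.2) :=
    hf.comp (by fun_prop)
  exact (h.stronglyMeasurable.integral_prod_right (ν := stdGaussian F)).measurable

lemma mehler_mem_Icc {f : F → ℝ} (hf : Measurable f) (h : ∀ x, f x ∈ Icc (0 : ℝ) 1) (θ : ℝ)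
    (x : F) : mehler θ f x ∈ Icc (0 : ℝ) 1 := by
  refine ⟨integral_nonneg fun y => (h _).1, ?_⟩
  have hm : Measurable fun y : F => f (Real.cos θ • x + Real.sin θ • y) := hf.comp (by fun_prop)
  calc mehler θ f x ≤ ∫ _, (1 : ℝ) ∂stdGaussian F :=
        integral_mono (integrable_of_mem_Icc hm fun y => h _) (integrable_const _)
          fun y => (h _).2
    _ = 1 := by simp

/-- The Ornstein-Uhlenbeck operators are symmetric. -/
lemma integral_mul_mehler {f g : F → ℝ} (hf : Measurable f) (h : ∀ x, f x ∈ Icc (0 : ℝ) 1)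
    (hgm : Measurable g) (hg : Integrable g (stdGaussian F)) (θ : ℝ) :
    ∫ x, g x * mehler θ f x ∂stdGaussian F = ∫ x, f x * mehler θ g x ∂stdGaussian F := by
  set c := Real.cos θ
  set s := Real.sin θ
  have hmf : Measurable fun p : F × F => f (c • p.1 + s • p.2) := hf.comp (by fun_prop)
  have hmg : Measurable fun p : F × F => g (c • p.1 + (-s) • p.2) := hgm.comp (by fun_prop)
  have hK : Integrable (fun p : F × F => g p.1 * f (c • p.1 + s • p.2))
      ((stdGaussian F).prod (stdGaussian F)) := by
    refine (hg.comp_fst (stdGaussian F)).mul_bdd (c := 1) hmf.aestronglyMeasurable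
      (Eventually.of_forall fun x => ?_)
    rw [Real.norm_of_nonneg (h _).1]; exact (h _).2
  -- If `(u, w)` is the rotated pair, then `u = c x + s y` and `x = c u - s w`. The rotation
  -- preserves `γ ⊗ γ` and exchanges the roles of the two arguments.
  have hrot : ∀ p : F × F, f (ContinuousLinearMap.rotation θ p).1 *
      g (c • (ContinuousLinearMap.rotation θ p).1 + (-s) • (ContinuousLinearMap.rotation θ p).2) =
      g p.1 * f (c • p.1 + s • p.2) := by
    intro p
    have hcs : c * c + s * s = 1 := by
      have := Real.cos_sq_add_sin_sq θ
      simp only [c, s]; nlinarith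
    have e : c • (c • p.1 + s • p.2) + (-s) • (-s • p.1 + c • p.2) = p.1 := by
      have : c • (c • p.1 + s • p.2) + (-s) • (-s • p.1 + c • p.2) = (c * c + s * s) • p.1 := by
        module
      rw [this, hcs, one_smul]
    rw [ContinuousLinearMap.rotation_apply]
    simp only
    rw [mul_comm, e]
  have hK' : Integrable (fun p : F × F => f p.1 * g (c • p.1 + (-s) • p.2))
      ((stdGaussian F).prod (stdGaussian F)) := by
    rw [← stdGaussian_prod_map_rotation θ, integrable_map_measure]
    · exact hK.congr (Eventually.of_forall fun p => (hrot p).symm)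
    · exact ((hf.comp measurable_fst).mul hmg).aestronglyMeasurable
    · fun_prop
  calc ∫ x, g x * mehler θ f x ∂stdGaussian F
      = ∫ x, ∫ y, g x * f (c • x + s • y) ∂stdGaussian F ∂stdGaussian F := by
        simp_rw [integral_const_mul]; rfl
    _ = ∫ p, g p.1 * f (c • p.1 + s • p.2) ∂(stdGaussian F).prod (stdGaussian F) :=
        (integral_prod _ hK).symm
    _ = ∫ p, f p.1 * g (c • p.1 + (-s) • p.2) ∂(stdGaussian F).prod (stdGaussian F) := by
        conv_rhs => rw [← stdGaussian_prod_map_rotation θ]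
        rw [integral_map (by fun_prop)]
        · exact integral_congr_ae (Eventually.of_forall fun p => (hrot p).symm)
        · exact ((hf.comp measurable_fst).mul hmg).aestronglyMeasurable
    _ = ∫ x, ∫ y, f x * g (c • x + (-s) • y) ∂stdGaussian F ∂stdGaussian F :=
        integral_prod _ hK'
    _ = ∫ x, f x * mehler θ g x ∂stdGaussian F := by
        congr 1 with x
        -- The symmetry of `γ` under `y ↦ -y` absorbs the sign of `-s`.
        rw [integral_const_mul, mehler, ← integral_stdGaussian_neg]
        simp only [smul_neg, neg_smul, neg_neg]
        rfl

lemma integral_mehler {f : F → ℝ} (hf : Measurable f) (h : ∀ x, f x ∈ Icc (0 : ℝ) 1) (θ : ℝ) :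
    ∫ x, mehler θ f x ∂stdGaussian F = ∫ x, f x ∂stdGaussian F := by
  have := integral_mul_mehler hf h (g := fun _ => 1) measurable_const (integrable_const _) θ
  simpa [mehler] using this

/-- Pointwise `|P f - P g| ≤ P |f - g|`, and `P` preserves the Gaussian mean. -/
lemma integral_abs_mehler_sub_le {f g : F → ℝ} (hf : Measurable f)
    (h : ∀ x, f x ∈ Icc (0 : ℝ) 1) (hg : Measurable g) (h' : ∀ x, g x ∈ Icc (0 : ℝ) 1) (θ : ℝ) :
    ∫ x, |mehler θ f x - mehler θ g x| ∂stdGaussian F ≤ ∫ x, |f x - g x| ∂stdGaussian F := by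
  have hd : Measurable fun x => |f x - g x| := by fun_prop
  have hd' : ∀ x, |f x - g x| ∈ Icc (0 : ℝ) 1 := fun x =>
    ⟨abs_nonneg _, abs_sub_le_iff.2 ⟨by linarith [(h x).2, (h' x).1], by
      linarith [(h' x).2, (h x).1]⟩⟩
  have hm : ∀ {k : F → ℝ}, Measurable k → ∀ x : F,
      Measurable fun y : F => k (Real.cos θ • x + Real.sin θ • y) := fun hk x => hk.comp (by fun_prop)
  rw [← integral_mehler hd hd' θ]
  refine integral_mono ?_ (integrable_of_mem_Icc (measurable_mehler hd θ) (mehler_mem_Icc hd hd' θ))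
    fun x => ?_
  · exact ((integrable_of_mem_Icc (measurable_mehler hf θ) (mehler_mem_Icc hf h θ)).sub
      (integrable_of_mem_Icc (measurable_mehler hg θ) (mehler_mem_Icc hg h' θ))).abs
  · simp only [mehler]
    rw [← integral_sub (integrable_of_mem_Icc (hm hf x) fun _ => h _)
      (integrable_of_mem_Icc (hm hg x) fun _ => h' _)]
    exact abs_integral_le_integral_abs

/-- The Ornstein-Uhlenbeck operators are strongly continuous in `L¹`. -/
lemma tendsto_integral_abs_mehler_sub {f : F → ℝ} (hf : Measurable f)
    (h : ∀ x, f x ∈ Icc (0 : ℝ) 1) :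
    Tendsto (fun θ => ∫ x, |mehler θ f x - f x| ∂stdGaussian F) (𝓝 0) (𝓝 0) := by
  have hint : ∀ {k : F → ℝ}, Measurable k → (∀ x, k x ∈ Icc (0 : ℝ) 1) →
      Integrable k (stdGaussian F) := fun hk hk' => integrable_of_mem_Icc hk hk'
  rw [Metric.tendsto_nhds]
  intro ε hε
  obtain ⟨g₀, hg₀, -⟩ := (hint hf h).exists_boundedContinuous_integral_sub_le
    (show 0 < ε / 3 by positivity)
  -- Truncation to `[0, 1]` brings the approximant no farther from `f`, which is its own truncation,
  -- and makes the contraction estimate applicable to `g`.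
  set g : F → ℝ := fun x => max 0 (min (g₀ x) 1)
  have hgc : Continuous g := by fun_prop
  have hgm : Measurable g := hgc.measurable
  have hg : ∀ x, g x ∈ Icc (0 : ℝ) 1 := fun x =>
    ⟨le_max_left _ _, max_le zero_le_one (min_le_right _ _)⟩
  have hfg : ∫ x, |f x - g x| ∂stdGaussian F ≤ ε / 3 := by
    refine le_trans (integral_mono ((hint hf h).sub (hint hgm hg)).abs
      ((hint hf h).sub (g₀.integrable _)).norm fun x => ?_) hg₀
    have e : f x = max 0 (min (f x) 1) := by rw [min_eq_left (h x).2, max_eq_right (h x).1]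
    simp only [g, Real.norm_eq_abs, Pi.sub_apply]
    calc |f x - max 0 (min (g₀ x) 1)| = |max 0 (min (f x) 1) - max 0 (min (g₀ x) 1)| := by rw [← e]
      _ ≤ |min (f x) 1 - min (g₀ x) 1| := by
        simpa using abs_max_sub_max_le_max 0 (min (f x) 1) 0 (min (g₀ x) 1)
      _ ≤ |f x - g₀ x| := by simpa using abs_min_sub_min_le_max (f x) 1 (g₀ x) 1
  have hmg : ∀ (θ : ℝ) (x : F), Measurable fun y : F => g (Real.cos θ • x + Real.sin θ • y) :=
    fun θ x => hgm.comp (by fun_prop)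
  have hcg : ∀ x, Tendsto (fun θ => mehler θ g x) (𝓝 0) (𝓝 (g x)) := fun x => by
    have e : g x = ∫ _, g x ∂stdGaussian F := by simp
    rw [e]
    refine tendsto_integral_filter_of_dominated_convergence (fun _ => 1)
      (Eventually.of_forall fun θ => (hmg θ x).aestronglyMeasurable)
      (Eventually.of_forall fun θ => Eventually.of_forall fun y => ?_) (integrable_const _)
      (Eventually.of_forall fun y => ?_)
    · rw [Real.norm_of_nonneg (hg _).1]; exact (hg _).2
    · have : Continuous fun θ => g (Real.cos θ • x + Real.sin θ • y) := by fun_prop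
      simpa using this.tendsto 0
  have hlim : Tendsto (fun θ => ∫ x, |mehler θ g x - g x| ∂stdGaussian F) (𝓝 0) (𝓝 0) := by
    have e : (0 : ℝ) = ∫ _, (0 : ℝ) ∂stdGaussian F := by simp
    conv => rw [e]; arg 2; rw [← e]
    refine tendsto_integral_filter_of_dominated_convergence (fun _ => 1)
      (Eventually.of_forall fun θ => ((measurable_mehler hgm θ).sub hgm).norm.aestronglyMeasurable)
      (Eventually.of_forall fun θ => Eventually.of_forall fun x => ?_) (integrable_const _)
      (Eventually.of_forall fun x => ?_)
    · rw [norm_abs_eq_norm, Real.norm_eq_abs]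
      have h1 := mehler_mem_Icc hgm hg θ x
      exact abs_sub_le_iff.2 ⟨by linarith [h1.2, (hg x).1], by linarith [(hg x).2, h1.1]⟩
    · simpa using ((hcg x).sub_const (g x)).abs
  filter_upwards [hlim.eventually (gt_mem_nhds (show 0 < ε / 3 by positivity))] with θ hθ
  rw [Real.dist_eq, sub_zero, abs_of_nonneg (integral_nonneg fun _ => abs_nonneg _)]
  have i1 := hint (measurable_mehler hf θ) (mehler_mem_Icc hf h θ)
  have i2 := hint (measurable_mehler hgm θ) (mehler_mem_Icc hgm hg θ)
  have i3 := hint hf h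
  have i4 := hint hgm hg
  calc ∫ x, |mehler θ f x - f x| ∂stdGaussian F
      ≤ ∫ x, (|mehler θ f x - mehler θ g x| + |mehler θ g x - g x| + |f x - g x|)
          ∂stdGaussian F := by
        refine integral_mono (i1.sub i3).abs
          (((i1.sub i2).abs.add (i2.sub i4).abs).add (i3.sub i4).abs) fun x => ?_
        have := abs_sub_le (mehler θ f x) (mehler θ g x) (g x)
        have h2 := abs_sub_le (mehler θ f x) (g x) (f x)
        rw [abs_sub_comm (g x) (f x)] at h2
        simp only
        linarith
    _ = (∫ x, |mehler θ f x - mehler θ g x| ∂stdGaussian F) +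
          (∫ x, |mehler θ g x - g x| ∂stdGaussian F) + ∫ x, |f x - g x| ∂stdGaussian F := by
        have j1 : Integrable (fun x => |mehler θ f x - mehler θ g x|) (stdGaussian F) :=
          (i1.sub i2).abs
        have j2 : Integrable (fun x => |mehler θ g x - g x|) (stdGaussian F) := (i2.sub i4).abs
        have j3 : Integrable (fun x => |f x - g x|) (stdGaussian F) := (i3.sub i4).abs
        rw [integral_add (f := fun x => |mehler θ f x - mehler θ g x| + |mehler θ g x - g x|)
          (j1.add j2) j3, integral_add j1 j2]
    _ < ε := by
        have := integral_abs_mehler_sub_le hf h hgm hg θ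
        linarith

end Measurable

variable [MeasureSpace F] [BorelSpace F]

/-- `Ψ` is the density of the standard Gaussian measure. -/
structure IsGaussianDensity (Ψ : F → ℝ) : Prop where
  stdGaussian_eq : stdGaussian F = (volume : Measure F).withDensity fun x => ENNReal.ofReal (Ψ x)
  exists_eq_exp : ∃ κ, 0 < κ ∧ ∀ x, Ψ x = κ * Real.exp (-‖x‖ ^ 2 / 2)

namespace IsGaussianDensity

set_option linter.unusedSectionVars false

variable {Ψ : F → ℝ} (hΨ : IsGaussianDensity Ψ)
include hΨ

lemma pos (x : F) : 0 < Ψ x := by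
  obtain ⟨κ, hκ, h⟩ := hΨ.exists_eq_exp
  rw [h]; positivity

lemma contDiff {n : WithTop ℕ∞} : ContDiff ℝ n Ψ := by
  obtain ⟨κ, hκ, h⟩ := hΨ.exists_eq_exp
  rw [funext h]
  exact contDiff_const.mul (((contDiff_norm_sq ℝ).neg.div_const 2).exp)

lemma continuous : Continuous Ψ := (hΨ.contDiff (n := 0)).continuous

lemma hasFDerivAt (x : F) : HasFDerivAt Ψ (-(Ψ x) • innerSL ℝ x) x := by
  obtain ⟨κ, hκ, h⟩ := hΨ.exists_eq_exp
  have h1 := (((hasStrictFDerivAt_norm_sq x).hasFDerivAt.neg.mul_const (1 / 2 : ℝ)).exp).const_mul κ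
  have e : Ψ = fun x => κ * Real.exp (-‖x‖ ^ 2 * (1 / 2)) := by
    funext x; rw [h]; ring_nf
  rw [e]
  refine h1.congr_fderiv ?_
  ext v
  simp
  ring

lemma integral_eq {G : Type*} [NormedAddCommGroup G] [NormedSpace ℝ G] (f : F → G) :
    ∫ x, f x ∂stdGaussian F = ∫ x, Ψ x • f x := by
  rw [hΨ.stdGaussian_eq, integral_withDensity_eq_integral_toReal_smul
    hΨ.continuous.measurable.ennreal_ofReal (by simp)]
  simp_rw [ENNReal.toReal_ofReal (hΨ.pos _).le]

lemma setIntegral_eq (f : F → ℝ) {E : Set F} (hE : MeasurableSet E) :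
    ∫ x in E, f x ∂stdGaussian F = ∫ x in E, Ψ x * f x := by
  rw [← integral_indicator hE, hΨ.integral_eq, ← integral_indicator hE]
  congr 1 with x
  by_cases hx : x ∈ E <;> simp [hx]

lemma integrable_iff {G : Type*} [NormedAddCommGroup G] [NormedSpace ℝ G] (f : F → G) :
    Integrable f (stdGaussian F) ↔ Integrable fun x => Ψ x • f x := by
  rw [hΨ.stdGaussian_eq, integrable_withDensity_iff_integrable_smul'
    hΨ.continuous.measurable.ennreal_ofReal (by simp)]
  simp_rw [ENNReal.toReal_ofReal (hΨ.pos _).le]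

lemma apply_sub (z h : F) : Ψ (z - h) = Ψ z * Real.exp (inner ℝ h z - ‖h‖ ^ 2 / 2) := by
  obtain ⟨κ, hκ, h'⟩ := hΨ.exists_eq_exp
  rw [h', h', mul_assoc, ← Real.exp_add, norm_sub_sq_real, real_inner_comm]
  ring_nf

variable [(volume : Measure F).IsAddHaarMeasure]

/-- The Cameron-Martin formula. -/
lemma integral_comp_add (f : F → ℝ) (h : F) :
    ∫ z, f (z + h) ∂stdGaussian F =
      ∫ z, f z * Real.exp (inner ℝ h z - ‖h‖ ^ 2 / 2) ∂stdGaussian F := by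
  rw [hΨ.integral_eq, hΨ.integral_eq, ← integral_sub_right_eq_self _ h]
  congr 1 with z
  rw [sub_add_cancel, hΨ.apply_sub, smul_eq_mul, smul_eq_mul]
  ring

lemma integrable_mul_exp {f : F → ℝ} {h : F}
    (hf : Integrable (fun z => f (z + h)) (stdGaussian F)) :
    Integrable (fun z => f z * Real.exp (inner ℝ h z - ‖h‖ ^ 2 / 2)) (stdGaussian F) := by
  rw [hΨ.integrable_iff] at hf ⊢
  refine (hf.comp_sub_right h).congr (Eventually.of_forall fun z => ?_)
  simp only
  rw [sub_add_cancel, hΨ.apply_sub, smul_eq_mul, smul_eq_mul]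
  ring

/-- Among all functions with values in `[0, 1]` of given Gaussian mean, the mean of a translate
is largest for the indicator function of a half-space. -/
lemma integral_comp_sub_le {f : F → ℝ} (hf : Measurable f) (hf' : ∀ x, f x ∈ Icc (0 : ℝ) 1)
    {e : F} (he : ‖e‖ = 1) {r s : ℝ} (hr : 0 ≤ r) (hs : ∫ z, f z ∂stdGaussian F = Φ₁ s) :
    ∫ z, f (z - r • e) ∂stdGaussian F ≤ Φ₁ (s + r) := by
  set H : Set F := {z | inner ℝ e z ≤ s}
  have hl : Measurable fun z : F => inner ℝ e z := by fun_prop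
  have hHm : MeasurableSet H := hl measurableSet_Iic
  set k : F → ℝ := H.indicator 1
  have hk : Measurable k := measurable_one.indicator hHm
  have hk' : ∀ x, k x ∈ Icc (0 : ℝ) 1 := fun x => by
    by_cases hx : x ∈ H <;> simp [k, hx]
  have hhalf : ∀ t, (stdGaussian F).real {z | inner ℝ e z ≤ t} = Φ₁ t := fun t => by
    rw [cdf_eq_real, ← stdGaussian_map_inner he, map_measureReal_apply hl measurableSet_Iic]
    rfl
  have hks : ∫ z, k z ∂stdGaussian F = Φ₁ s := by
    simp only [k]
    rw [integral_indicator_one hHm, hhalf]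
  have hkr : ∫ z, k (z + (-(r • e))) ∂stdGaussian F = Φ₁ (s + r) := by
    have hHr : MeasurableSet {z : F | inner ℝ e z ≤ s + r} := hl measurableSet_Iic
    rw [← hhalf, ← integral_indicator_one hHr]
    congr 1 with z
    have : z + -(r • e) ∈ H ↔ z ∈ {z | inner ℝ e z ≤ s + r} := by
      simp only [H, Set.mem_ofPred_eq, inner_add_right, inner_neg_right, inner_smul_right,
        real_inner_self_eq_norm_sq, he]
      constructor <;> intro <;> linarith
    by_cases hz : z ∈ {z | inner ℝ e z ≤ s + r}
    · simp [k, this.2 hz, hz]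
    · simp [k, mt this.1 hz, hz]
  have hshift : ∀ {g : F → ℝ}, Measurable g → (∀ x, g x ∈ Icc (0 : ℝ) 1) → Integrable
      (fun z => g z * Real.exp (inner ℝ (-(r • e)) z - ‖-(r • e)‖ ^ 2 / 2)) (stdGaussian F) :=
    fun hg hg' => hΨ.integrable_mul_exp
      (integrable_of_mem_Icc (hg.comp (by fun_prop)) fun x => hg' _)
  set W : F → ℝ := fun z => Real.exp (inner ℝ (-(r • e)) z - ‖-(r • e)‖ ^ 2 / 2)
  have hW : ∀ z, W z = Real.exp (-r * inner ℝ e z - r ^ 2 / 2) := fun z => by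
    simp [W, inner_neg_left, inner_smul_left, norm_smul, he]
  -- The value on the hyperplane `⟨e, z⟩ = s` of the Cameron-Martin weight `W`. The weight decreases
  -- in `⟨e, z⟩`, so `W ≥ c` on `H` and `W ≤ c` off it; hence `(f - k) (W - c) ≤ 0` everywhere, as
  -- in the Neyman-Pearson lemma.
  set c := Real.exp (-r * s - r ^ 2 / 2)
  have hfi := integrable_of_mem_Icc (μ := stdGaussian F) hf hf'
  have hki := integrable_of_mem_Icc (μ := stdGaussian F) hk hk'
  have key : ∫ z, (f z * W z - k z * W z) ∂stdGaussian F ≤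
      ∫ z, c * (f z - k z) ∂stdGaussian F := by
    refine integral_mono ((hshift hf hf').sub (hshift hk hk')) ((hfi.sub hki).const_mul c)
      fun z => ?_
    simp only
    have := hf' z
    by_cases hz : inner ℝ e z ≤ s
    · have h1 : k z = 1 := by simp [k, H, hz]
      have h2 : c ≤ W z := by
        rw [hW]; exact Real.exp_le_exp.2 (by nlinarith)
      rw [h1]
      nlinarith [this.2]
    · have h1 : k z = 0 := by simp [k, H, hz]
      have h2 : W z ≤ c := by
        rw [hW]; exact Real.exp_le_exp.2 (by nlinarith)
      rw [h1]
      nlinarith [this.1]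
  rw [integral_sub (hshift hf hf') (hshift hk hk'), integral_const_mul, integral_sub hfi hki, hs,
    hks, sub_self, mul_zero, ← hΨ.integral_comp_add, ← hΨ.integral_comp_add, hkr] at key
  simp only [sub_eq_add_neg]
  linarith

/-- A change of base point in `P_θ f` is a translation of the integration variable, and by
Cameron-Martin translations preserve Gaussian null sets. A zero at one point would therefore make
`P_θ f` vanish everywhere, against its positive mean. -/
lemma mehler_pos {f : F → ℝ} (hf : Measurable f) (hf' : ∀ x, f x ∈ Icc (0 : ℝ) 1)
    (h0 : 0 < ∫ x, f x ∂stdGaussian F) {θ : ℝ} (hθ : 0 < Real.sin θ) (x : F) :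
    0 < mehler θ f x := by
  refine (mehler_mem_Icc hf hf' θ x).1.lt_of_ne fun hx => h0.ne ?_
  have hm : Measurable fun y : F => f (Real.cos θ • x + Real.sin θ • y) := hf.comp (by fun_prop)
  have hz : (fun y : F => f (Real.cos θ • x + Real.sin θ • y)) =ᵐ[stdGaussian F] 0 :=
    (integral_eq_zero_iff_of_nonneg (fun y => (hf' _).1)
      (integrable_of_mem_Icc hm fun y => hf' _)).1 hx.symm
  rw [← integral_mehler hf hf' θ]
  refine (integral_eq_zero_of_ae (Eventually.of_forall fun x' => ?_)).symm
  set w := (Real.cos θ / Real.sin θ) • (x' - x)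
  have e : mehler θ f x' =
      ∫ y, (fun y : F => f (Real.cos θ • x + Real.sin θ • y)) (y + w) ∂stdGaussian F := by
    simp only [mehler]
    congr 1 with y
    congr 1
    simp only [w, smul_add, smul_smul, mul_div_cancel₀ _ hθ.ne', smul_sub]
    abel
  rw [e, hΨ.integral_comp_add (fun y => f (Real.cos θ • x + Real.sin θ • y))]
  refine integral_eq_zero_of_ae ?_
  filter_upwards [hz] with y hy
  rw [hy]; simp

lemma mehler_mem_Ioo {f : F → ℝ} (hf : Measurable f) (hf' : ∀ x, f x ∈ Icc (0 : ℝ) 1)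
    (h0 : ∫ x, f x ∂stdGaussian F ∈ Ioo (0 : ℝ) 1) {θ : ℝ} (hθ : 0 < Real.sin θ) (x : F) :
    mehler θ f x ∈ Ioo (0 : ℝ) 1 := by
  refine ⟨hΨ.mehler_pos hf hf' h0.1 hθ x, ?_⟩
  have hm : Measurable fun y : F => f (Real.cos θ • x + Real.sin θ • y) := hf.comp (by fun_prop)
  have h1 := hΨ.mehler_pos (f := fun x => 1 - f x) (by fun_prop)
    (fun x => ⟨by linarith [(hf' x).2], by linarith [(hf' x).1]⟩) (by
      rw [integral_sub (integrable_const _) (integrable_of_mem_Icc hf hf')]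
      simpa using h0.2) hθ x
  rw [mehler, integral_sub (integrable_const _) (integrable_of_mem_Icc hm fun y => hf' _)] at h1
  simp only [integral_const, probReal_univ, smul_eq_mul, mul_one, sub_pos] at h1
  exact h1

/-- The reverse isoperimetric inequality for the Ornstein-Uhlenbeck semigroup. -/
lemma quantile_mehler_le {f : F → ℝ} (hf : Measurable f) (hf' : ∀ x, f x ∈ Icc (0 : ℝ) 1)
    (h0 : ∫ x, f x ∂stdGaussian F ∈ Ioo (0 : ℝ) 1) {θ : ℝ} (hθ : 0 < Real.sin θ)
    (hθ' : 0 ≤ Real.cos θ) (x x' : F) :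
    gaussianQuantile (mehler θ f x') ≤
      gaussianQuantile (mehler θ f x) + Real.cos θ / Real.sin θ * ‖x' - x‖ := by
  rcases eq_or_ne x' x with rfl | hne
  · simp
  have hn : 0 < ‖x' - x‖ := norm_pos_iff.2 (sub_ne_zero.2 hne)
  have hm : Measurable fun y : F => f (Real.cos θ • x + Real.sin θ • y) := hf.comp (by fun_prop)
  -- Moving `x` to `x'` shifts the argument of `f` by `cos θ (x' - x)`, which is a translation of
  -- `y` of length `r`. The extremality of half-spaces then gives `P_θ f(x') ≤ Φ(Φ⁻¹(P_θ f(x)) +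
  -- r)`.
  set r := Real.cos θ / Real.sin θ * ‖x' - x‖
  have key := hΨ.integral_comp_sub_le (f := fun y : F => f (Real.cos θ • x + Real.sin θ • y)) hm
    (fun y => hf' _) (e := ‖x' - x‖⁻¹ • (x - x')) (by
      rw [norm_smul, norm_sub_rev x x', norm_inv, norm_norm, inv_mul_cancel₀ hn.ne'])
    (r := r) (by positivity) (stdCDF_quantile (hΨ.mehler_mem_Ioo hf hf' h0 hθ x)).symm
  have e : mehler θ f x' = ∫ y, f (Real.cos θ • x + Real.sin θ • (y - r • ‖x' - x‖⁻¹ • (x - x')))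
      ∂stdGaussian F := by
    simp only [mehler]
    congr 1 with y
    congr 1
    have : Real.sin θ * (r * ‖x' - x‖⁻¹) = Real.cos θ := by
      simp only [r]; field_simp
    rw [smul_smul, smul_sub, smul_smul, this, smul_sub]
    abel
  rw [← e] at key
  rw [← strictMono_stdCDF.le_iff_le, stdCDF_quantile (hΨ.mehler_mem_Ioo hf hf' h0 hθ x')]
  exact key

end IsGaussianDensity

end GaussianSpace

/-! ### Divergence -/

section Divergence

variable {F : Type*} [NormedAddCommGroup F] [InnerProductSpace ℝ F] [FiniteDimensional ℝ F]

/-- The trace of a continuous linear endomorphism, as a continuous linear functional. -/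
def traceCLM : (F →L[ℝ] F) →L[ℝ] ℝ :=
  LinearMap.toContinuousLinearMap
    ((LinearMap.trace ℝ F).comp (ContinuousLinearMap.coeLM ℝ : (F →L[ℝ] F) →ₗ[ℝ] F →ₗ[ℝ] F))

lemma divergence_eq (X : F → F) (x : F) : divergence X x = traceCLM (fderiv ℝ X x) := rfl

lemma traceCLM_smulRight (f : F →L[ℝ] ℝ) (v : F) : traceCLM (f.smulRight v) = f v :=
  LinearMap.trace_smulRight (f : F →ₗ[ℝ] ℝ) v

lemma traceCLM_eq_sum {ι : Type*} [Fintype ι] [DecidableEq ι] (b : OrthonormalBasis ι ℝ F)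
    (T : F →L[ℝ] F) : traceCLM T = ∑ i, inner ℝ (b i) (T (b i)) :=
  LinearMap.trace_eq_sum_inner (T : F →ₗ[ℝ] F) b

lemma continuous_divergence {X : F → F} (hX : ContDiff ℝ 1 X) : Continuous (divergence X) :=
  traceCLM.continuous.comp (hX.continuous_fderiv one_ne_zero)

lemma hasCompactSupport_divergence {X : F → F} (hX : HasCompactSupport X) :
    HasCompactSupport (divergence X) :=
  (hX.fderiv ℝ).comp_left (g := traceCLM) (map_zero _)

lemma divergence_smul {c : F → ℝ} {X : F → F} {x : F} (hc : DifferentiableAt ℝ c x)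
    (hX : DifferentiableAt ℝ X x) :
    divergence (fun y => c y • X y) x = c x * divergence X x + fderiv ℝ c x (X x) := by
  rw [divergence_eq, fderiv_fun_smul hc hX, map_add, map_smul, traceCLM_smulRight]
  rfl

variable [MeasureSpace F] [BorelSpace F] [(volume : Measure F).IsAddHaarMeasure]

lemma integral_fderiv_apply_eq_zero {f : F → ℝ} (hf : ContDiff ℝ 1 f) (hs : HasCompactSupport f)
    (v : F) : ∫ x, fderiv ℝ f x v = 0 := by
  have hc : Continuous fun x => fderiv ℝ f x v :=
    (hf.continuous_fderiv one_ne_zero).clm_apply continuous_const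
  have hs' : HasCompactSupport fun x => fderiv ℝ f x v :=
    (hs.fderiv ℝ).comp_left (g := fun T : F →L[ℝ] ℝ => T v) rfl
  have := integral_mul_fderiv_eq_neg_fderiv_mul_of_integrable (μ := (volume : Measure F))
    (f := fun _ => (1 : ℝ)) (g := f) (v := v) (by simp)
    (by simpa using hc.integrable_of_hasCompactSupport hs')
    (by simpa using hf.continuous.integrable_of_hasCompactSupport hs)
    (fun _ _ => differentiableAt_const _) (fun x _ => hf.differentiable one_ne_zero x)
  simpa using this

/-- The divergence theorem for compactly supported fields. -/
lemma integral_divergence_eq_zero {X : F → F} (hX : ContDiff ℝ 1 X) (hs : HasCompactSupport X) :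
    ∫ x, divergence X x = 0 := by
  let b := stdOrthonormalBasis ℝ F
  have e : ∀ x, divergence X x = ∑ i, fderiv ℝ (fun y => inner ℝ (b i) (X y)) x (b i) := by
    intro x
    rw [divergence_eq, traceCLM_eq_sum b]
    refine Finset.sum_congr rfl fun i _ => ?_
    rw [fderiv_inner_apply ℝ (differentiableAt_const _) (hX.differentiable one_ne_zero x)]
    simp
  have hc : ∀ i, ContDiff ℝ 1 fun y => inner ℝ (b i) (X y) := fun i => contDiff_const.inner ℝ hX
  have hs' : ∀ i, HasCompactSupport fun y => inner ℝ (b i) (X y) := fun i =>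
    hs.comp_left (g := fun z => inner ℝ (b i) z) (inner_zero_right _)
  simp_rw [e]
  rw [integral_finsetSum]
  · exact Finset.sum_eq_zero fun i _ => integral_fderiv_apply_eq_zero (hc i) (hs' i) _
  · intro i _
    exact (((hc i).continuous_fderiv one_ne_zero).clm_apply
      continuous_const).integrable_of_hasCompactSupport
        (((hs' i).fderiv ℝ).comp_left (g := fun T : F →L[ℝ] ℝ => T (b i)) rfl)

end Divergence

/-! ### The Gaussian perimeter -/

section GaussianPerimeter

set_option linter.unusedSectionVars false

variable {F : Type*} [NormedAddCommGroup F] [InnerProductSpace ℝ F] [FiniteDimensional ℝ F]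
  [MeasureSpace F] [BorelSpace F]

namespace IsGaussianDensity

variable {Ψ : F → ℝ} (hΨ : IsGaussianDensity Ψ)
include hΨ

lemma divergence_smul {X : F → F} {x : F} (hX : DifferentiableAt ℝ X x) :
    divergence (fun y => Ψ y • X y) x = Ψ x * (divergence X x - inner ℝ x (X x)) := by
  rw [GaussianSlab.divergence_smul (hΨ.hasFDerivAt x).differentiableAt hX,
    (hΨ.hasFDerivAt x).fderiv]
  simp
  ring

/-- The perimeter bounds the flux of every bounded field, compactly supported or not. -/
lemma setIntegral_le_perimeter {E : Set F} (hE : MeasurableSet E)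
    (hA : weightedPerimeter univ Ψ E ≠ ∞) {X : F → F} (hX : ContDiff ℝ 1 X) {M : ℝ} (hM : 0 < M)
    (hXM : ∀ x, ‖X x‖ ≤ M)
    (hd : Integrable (fun x => divergence X x - inner ℝ x (X x)) (stdGaussian F)) :
    ∫ x in E, (divergence X x - inner ℝ x (X x)) ∂stdGaussian F ≤
      M * (weightedPerimeter univ Ψ E).toReal := by
  set A := weightedPerimeter univ Ψ E
  let b : ContDiffBump (0 : F) := ⟨1, 2, one_pos, one_lt_two⟩
  have hb : ContDiff ℝ 1 b := b.contDiff
  obtain ⟨C, hC⟩ : ∃ C, ∀ x, ‖fderiv ℝ b x‖ ≤ C :=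
    (hb.continuous_fderiv one_ne_zero).bounded_above_of_compact_support (b.hasCompactSupport.fderiv ℝ)
  have hC0 : 0 ≤ C := (norm_nonneg _).trans (hC 0)
  -- The cut-offs `b (r_k x)` take values in `[0, 1]`, tend to 1 and have gradients at most `C r_k`.
  -- The error term `⟨∇c_k, X⟩` is thus dominated by the constant `C M` and disappears in the limit.
  set r : ℕ → ℝ := fun k => 1 / ((k : ℝ) + 1)
  have hr0 : ∀ k, 0 < r k := fun k => Nat.one_div_pos_of_nat
  have hr1 : ∀ k, r k ≤ 1 := fun k => by
    simp only [r]
    rw [div_le_one (by positivity)]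
    linarith [Nat.cast_nonneg (α := ℝ) k]
  have hr : Tendsto r atTop (𝓝 0) := tendsto_one_div_add_atTop_nhds_zero_nat
  set c : ℕ → F → ℝ := fun k x => b (r k • x)
  have hcd : ∀ k, ContDiff ℝ 1 (c k) := fun k => hb.comp (contDiff_const_smul (r k))
  have hcf : ∀ k x, fderiv ℝ (c k) x = r k • fderiv ℝ b (r k • x) := fun k x => by
    simp only [c]
    rw [fderiv_comp_smul]
  have hc0 : ∀ k x, 0 ≤ c k x := fun k x => b.nonneg
  have hc1 : ∀ k x, c k x ≤ 1 := fun k x => b.le_one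
  have hcs : ∀ k, HasCompactSupport (c k) := fun k => b.hasCompactSupport.comp_smul (hr0 k).ne'
  set d : F → ℝ := fun x => divergence X x - inner ℝ x (X x)
  have hXd : ∀ x, DifferentiableAt ℝ X x := fun x => hX.differentiable one_ne_zero x
  have hstep : ∀ k, ∫ x in E, (c k x * d x + fderiv ℝ (c k) x (X x)) ∂stdGaussian F ≤
      M * A.toReal := by
    intro k
    -- Division by `M` makes the truncated field admissible.
    set Y : F → F := fun x => (M⁻¹ * c k x) • X x
    have hmd : ContDiff ℝ 1 fun x => M⁻¹ * c k x := contDiff_const.mul (hcd k)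
    have hY : Y ∈ testFields (interior (univ : Set F)) := by
      refine ⟨hmd.smul hX, ?_, by simp, fun x => ?_⟩
      · exact ((hcs k).mul_left (f := fun _ => M⁻¹)).smul_right
      · simp only [Y]
        rw [norm_smul, Real.norm_of_nonneg (mul_nonneg (inv_nonneg.2 hM.le) (hc0 k x)), mul_assoc,
          inv_mul_le_iff₀ hM, mul_one]
        exact (mul_le_of_le_one_left (norm_nonneg _) (hc1 k x)).trans (hXM x)
    have h1 : ∫ x in E, divergence (fun y => Ψ y • Y y) x ≤ A.toReal :=
      (ENNReal.ofReal_le_iff_le_toReal hA).1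
        (le_iSup₂ (f := fun Y (_ : Y ∈ testFields (interior (univ : Set F))) =>
          ENNReal.ofReal (∫ x in E, divergence (fun y => Ψ y • Y y) x)) Y hY)
    have e : ∀ x, divergence (fun y => Ψ y • Y y) x =
        Ψ x * (M⁻¹ * (c k x * d x + fderiv ℝ (c k) x (X x))) := by
      intro x
      have hcx : DifferentiableAt ℝ (c k) x := (hcd k).differentiable one_ne_zero x
      rw [hΨ.divergence_smul (X := Y) ((hmd.differentiable one_ne_zero x).smul (hXd x)),
        show divergence Y x = _ from
          GaussianSlab.divergence_smul (hmd.differentiable one_ne_zero x) (hXd x),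
        fderiv_const_mul hcx, show inner ℝ x (Y x) = _ from inner_smul_right _ _ _]
      simp only [d, FunLike.coe_smul, Pi.smul_apply, smul_eq_mul]
      ring
    simp_rw [e] at h1
    rw [← hΨ.setIntegral_eq _ hE, integral_const_mul, inv_mul_le_iff₀ hM] at h1
    exact h1
  have hdc : Continuous d := (continuous_divergence hX).sub (continuous_id.inner hX.continuous)
  refine le_of_tendsto' (tendsto_integral_of_dominated_convergence (fun x => |d x| + C * M)
    (fun k => ?_) (hd.abs.add (integrable_const _)).integrableOn (fun k => ?_) ?_) hstep
  · have h2 : Continuous fun x => fderiv ℝ (c k) x (X x) :=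
      ((hcd k).continuous_fderiv one_ne_zero).clm_apply hX.continuous
    exact (((hcd k).continuous.mul hdc).add h2).aestronglyMeasurable
  · refine Eventually.of_forall fun x => (norm_add_le _ _).trans (add_le_add ?_ ?_)
    · rw [norm_mul, Real.norm_of_nonneg (hc0 k x), Real.norm_eq_abs]
      exact mul_le_of_le_one_left (abs_nonneg _) (hc1 k x)
    · refine ((fderiv ℝ (c k) x).le_opNorm _).trans
        (mul_le_mul ?_ (hXM x) (norm_nonneg _) hC0)
      rw [hcf, norm_smul, Real.norm_of_nonneg (hr0 k).le]
      exact (mul_le_of_le_one_left (norm_nonneg _) (hr1 k)).trans (hC _)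
  · refine Eventually.of_forall fun x => ?_
    have hrx : Tendsto (fun k => r k • x) atTop (𝓝 0) := by simpa using hr.smul_const x
    have h3 : Tendsto (fun k => c k x) atTop (𝓝 1) := by
      have := (hb.continuous.tendsto 0).comp hrx
      rwa [b.one_of_mem_closedBall (by simp [b.rIn_pos.le])] at this
    have h4 : Tendsto (fun k => fderiv ℝ (c k) x (X x)) atTop (𝓝 0) := by
      simp_rw [hcf]
      have h5 := ((hb.continuous_fderiv one_ne_zero).tendsto 0).comp hrx
      have h6 := ((ContinuousLinearMap.apply ℝ ℝ (X x)).continuous.tendsto _).comp (hr.smul h5)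
      simpa [Function.comp_def] using h6
    simpa using (h3.mul_const (d x)).add h4

variable [(volume : Measure F).IsAddHaarMeasure]

/-- Stein's identity. -/
lemma integral_mul_inner {k : F → ℝ} (hk : ContDiff ℝ 1 k) {C L : ℝ}
    (hkC : ∀ y, |k y| ≤ C + L * ‖y‖) (hkL : ∀ y, ‖fderiv ℝ k y‖ ≤ L) (v : F) :
    ∫ y, k y * inner ℝ v y ∂stdGaussian F = ∫ y, fderiv ℝ k y v ∂stdGaussian F := by
  have hid : MemLp (fun y : F => y) 2 (stdGaussian F) := IsGaussian.memLp_id (stdGaussian F) 2 (by simp)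
  have hn1 := integrable_norm_stdGaussian (F := F)
  have hn2 : Integrable (fun y : F => ‖y‖ ^ 2) (stdGaussian F) := hid.integrable_norm_pow two_ne_zero
  have i1 : Integrable (fun y => k y * inner ℝ v y) (stdGaussian F) := by
    refine (((hn1.const_mul C).add (hn2.const_mul L)).const_mul ‖v‖).mono'
      (hk.continuous.mul (continuous_const.inner continuous_id)).aestronglyMeasurable
      (Eventually.of_forall fun y => ?_)
    have h1 := abs_real_inner_le_norm v y
    calc ‖k y * inner ℝ v y‖ = |k y| * |inner ℝ v y| := by rw [norm_mul]; rfl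
      _ ≤ (C + L * ‖y‖) * (‖v‖ * ‖y‖) :=
        mul_le_mul (hkC y) h1 (abs_nonneg _) ((abs_nonneg _).trans (hkC y))
      _ = ‖v‖ * (C * ‖y‖ + L * ‖y‖ ^ 2) := by ring
  have i2 : Integrable (fun y => fderiv ℝ k y v) (stdGaussian F) :=
    Integrable.of_bound ((hk.continuous_fderiv one_ne_zero).clm_apply
      continuous_const).aestronglyMeasurable (L * ‖v‖) (Eventually.of_forall fun y =>
        ((fderiv ℝ k y).le_opNorm v).trans (mul_le_mul_of_nonneg_right (hkL y) (norm_nonneg _)))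
  have i3 : Integrable k (stdGaussian F) :=
    ((integrable_const C).add (hn1.const_mul L)).mono' hk.continuous.aestronglyMeasurable
      (Eventually.of_forall hkC)
  rw [hΨ.integrable_iff] at i1 i2 i3
  have hΨf : ∀ y, fderiv ℝ Ψ y v = -(Ψ y * inner ℝ v y) := fun y => by
    rw [(hΨ.hasFDerivAt y).fderiv, real_inner_comm]; simp
  have key := integral_mul_fderiv_eq_neg_fderiv_mul_of_integrable (μ := (volume : Measure F))
    (f := k) (g := Ψ) (v := v)
    (i2.congr (Eventually.of_forall fun y => by simp [mul_comm]))
    (i1.neg.congr (Eventually.of_forall fun y => by simp [hΨf]; ring))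
    (i3.congr (Eventually.of_forall fun y => by simp [mul_comm]))
    (fun x _ => hk.differentiable one_ne_zero x)
    (fun x _ => (hΨ.hasFDerivAt x).differentiableAt)
  rw [hΨ.integral_eq, hΨ.integral_eq]
  have e1 : ∀ y, k y * fderiv ℝ Ψ y v = -(Ψ y • (k y * inner ℝ v y)) := fun y => by
    rw [hΨf, smul_eq_mul]; ring
  have e2 : ∀ y, fderiv ℝ k y v * Ψ y = Ψ y • fderiv ℝ k y v := fun y => by
    rw [smul_eq_mul, mul_comm]
  simp_rw [e1, e2] at key
  rw [integral_neg] at key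
  linarith

end IsGaussianDensity

end GaussianPerimeter

/-! ### The field generated by the Ornstein-Uhlenbeck flow -/

section MehlerField

set_option linter.unusedSectionVars false

variable {F : Type*} [NormedAddCommGroup F] [InnerProductSpace ℝ F] [FiniteDimensional ℝ F]

/-- A Lipschitz function on a finite-dimensional space is a uniform limit of `C¹` functions with
the same Lipschitz constant. -/
lemma exists_contDiff_approx [MeasurableSpace F] [BorelSpace F] {g : F → ℝ} {L : ℝ} (hL : 0 ≤ L)
    (hg : ∀ x y, |g x - g y| ≤ L * ‖x - y‖) {ε : ℝ} (hε : 0 < ε) :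
    ∃ k : F → ℝ, ContDiff ℝ 1 k ∧ (∀ x, |k x - g x| ≤ ε) ∧ ∀ x, ‖fderiv ℝ k x‖ ≤ L := by
  let μ : Measure F := Measure.addHaar
  have hgc : Continuous g := by
    refine (LipschitzWith.of_dist_le_mul (K := ⟨L, hL⟩) fun x y => ?_).continuous
    rw [Real.dist_eq, dist_eq_norm]
    exact hg x y
  -- Averaging over a ball of radius `ε / (L + 1)` moves `g` by at most `L ε / (L + 1) ≤ ε`; the
  -- summand 1 covers `L = 0`.
  let b : ContDiffBump (0 : F) := ⟨ε / (L + 1) / 2, ε / (L + 1), by positivity,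
    half_lt_self (by positivity)⟩
  have hbs : HasCompactSupport (b.normed μ) := b.hasCompactSupport_normed
  have hbc : ContDiff ℝ 1 (b.normed μ) := b.contDiff_normed
  let k : F → ℝ := convolution (b.normed μ) g (ContinuousLinearMap.lsmul ℝ ℝ) μ
  have hk : ContDiff ℝ 1 k :=
    hbs.contDiff_convolution_left _ hbc hgc.locallyIntegrable
  have hint : ∀ x, Integrable (fun t => b.normed μ t * g (x - t)) μ := fun x =>
    (hbc.continuous.mul (hgc.comp (by fun_prop))).integrable_of_hasCompactSupport hbs.mul_right
  have hke : ∀ x, k x = ∫ t, b.normed μ t * g (x - t) ∂μ := fun x => rfl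
  refine ⟨k, hk, fun x => ?_, fun x => norm_fderiv_le_of_lip' ℝ hL (Eventually.of_forall fun y => ?_)⟩
  · refine b.dist_normed_convolution_le hgc.aestronglyMeasurable fun y hy => ?_
    rw [Real.dist_eq]
    have hy' : ‖y - x‖ < ε / (L + 1) := by simpa [dist_eq_norm] using hy
    refine (hg y x).trans ((mul_le_mul_of_nonneg_left hy'.le hL).trans ?_)
    rw [mul_div_assoc', div_le_iff₀ (by positivity)]
    nlinarith
  · rw [hke, hke, ← integral_sub (hint y) (hint x)]
    calc ‖∫ t, (b.normed μ t * g (y - t) - b.normed μ t * g (x - t)) ∂μ‖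
        ≤ ∫ t, b.normed μ t * (L * ‖y - x‖) ∂μ := by
          refine norm_integral_le_of_norm_le ((hbc.continuous.integrable_of_hasCompactSupport
            hbs).mul_const _) (Eventually.of_forall fun t => ?_)
          rw [← mul_sub, norm_mul, Real.norm_of_nonneg (b.nonneg_normed t)]
          refine mul_le_mul_of_nonneg_left ?_ (b.nonneg_normed t)
          have := hg (y - t) (x - t)
          rwa [sub_sub_sub_cancel_right] at this
      _ = L * ‖y - x‖ := by rw [integral_mul_const, b.integral_normed, one_mul]

variable [MeasureSpace F] [BorelSpace F]

/-- The field whose Gaussian divergence is the increment of the Ornstein-Uhlenbeck flow of `g`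
between the angles `a` and `b`. -/
def mehlerField (a b : ℝ) (g : F → ℝ) (x : F) : F :=
  ∫ p, g (Real.cos p.1 • x + Real.sin p.1 • p.2) • p.2
    ∂((volume : Measure ℝ).restrict (Ioc a b)).prod (stdGaussian F)

lemma norm_rotate_le (x y : F) (t : ℝ) : ‖Real.cos t • x + Real.sin t • y‖ ≤ ‖x‖ + ‖y‖ := by
  refine (norm_add_le _ _).trans (add_le_add ?_ ?_)
  · rw [norm_smul]
    exact mul_le_of_le_one_left (norm_nonneg _) (Real.abs_cos_le_one t)
  · rw [norm_smul]
    exact mul_le_of_le_one_left (norm_nonneg _) (Real.abs_sin_le_one t)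

lemma integrable_norm_snd (a b : ℝ) : Integrable (fun p : ℝ × F => ‖p.2‖)
    (((volume : Measure ℝ).restrict (Ioc a b)).prod (stdGaussian F)) :=
  integrable_norm_stdGaussian.comp_snd (volume.restrict (Ioc a b))

section

variable {g : F → ℝ} {L : ℝ} (hg : ContDiff ℝ 1 g) (hL : ∀ x, ‖fderiv ℝ g x‖ ≤ L) {a b : ℝ}
include hg hL

lemma abs_le_of_norm_fderiv_le (x : F) : |g x| ≤ |g 0| + L * ‖x‖ := by
  have h := convex_univ.norm_image_sub_le_of_norm_fderiv_le (𝕜 := ℝ) (f := g) (C := L)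
    (fun x _ => hg.differentiable one_ne_zero x) (fun x _ => hL x) (mem_univ 0) (mem_univ x)
  rw [sub_zero, Real.norm_eq_abs] at h
  have := abs_sub_abs_le_abs_sub (g x) (g 0)
  linarith

lemma integrable_mehlerField (x : F) :
    Integrable (fun p : ℝ × F => g (Real.cos p.1 • x + Real.sin p.1 • p.2) • p.2)
      (((volume : Measure ℝ).restrict (Ioc a b)).prod (stdGaussian F)) := by
  have hid : MemLp (fun y : F => y) 2 (stdGaussian F) :=
    IsGaussian.memLp_id (stdGaussian F) 2 (by simp)
  have h1 := (integrable_norm_stdGaussian (F := F)).comp_snd ((volume : Measure ℝ).restrict (Ioc a b))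
  have h2 := (hid.integrable_norm_pow two_ne_zero).comp_snd ((volume : Measure ℝ).restrict (Ioc a b))
  have hL0 : 0 ≤ L := (norm_nonneg _).trans (hL 0)
  refine ((h1.const_mul (|g 0| + L * ‖x‖)).add (h2.const_mul L)).mono' ?_
    (Eventually.of_forall fun p => ?_)
  · have : Continuous fun p : ℝ × F => g (Real.cos p.1 • x + Real.sin p.1 • p.2) • p.2 :=
      (hg.continuous.comp (by fun_prop)).smul continuous_snd
    exact this.aestronglyMeasurable
  · rw [norm_smul, Real.norm_eq_abs]
    have h3 := abs_le_of_norm_fderiv_le hg hL (Real.cos p.1 • x + Real.sin p.1 • p.2)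
    have h4 := mul_le_mul_of_nonneg_left (norm_rotate_le x p.2 p.1) hL0
    calc |g (Real.cos p.1 • x + Real.sin p.1 • p.2)| * ‖p.2‖
        ≤ (|g 0| + L * (‖x‖ + ‖p.2‖)) * ‖p.2‖ :=
          mul_le_mul_of_nonneg_right (by linarith) (norm_nonneg _)
      _ = (|g 0| + L * ‖x‖) * ‖p.2‖ + L * ‖p.2‖ ^ 2 := by ring

lemma continuous_fderiv_rotate (x : F) : Continuous fun p : ℝ × F =>
    fderiv ℝ g (Real.cos p.1 • x + Real.sin p.1 • p.2) :=
  (hg.continuous_fderiv one_ne_zero).comp (by fun_prop)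

/-- An integrable bound that does not depend on `x`. It justifies differentiation under the integral
sign and the continuity of the derivative. -/
lemma norm_fderiv_mehlerField_le (x : F) (p : ℝ × F) :
    ‖(Real.cos p.1 • fderiv ℝ g (Real.cos p.1 • x + Real.sin p.1 • p.2)).smulRight p.2‖ ≤
      L * ‖p.2‖ := by
  rw [ContinuousLinearMap.norm_smulRight_apply, norm_smul]
  refine mul_le_mul_of_nonneg_right ?_ (norm_nonneg _)
  exact (mul_le_of_le_one_left (norm_nonneg _) (Real.abs_cos_le_one _)).trans (hL _)

lemma hasFDerivAt_mehlerField (x : F) :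
    HasFDerivAt (mehlerField a b g)
      (∫ p, (Real.cos p.1 • fderiv ℝ g (Real.cos p.1 • x + Real.sin p.1 • p.2)).smulRight p.2
        ∂((volume : Measure ℝ).restrict (Ioc a b)).prod (stdGaussian F)) x := by
  refine hasFDerivAt_integral_of_dominated_of_fderiv_le (s := univ)
    (F' := fun x (p : ℝ × F) =>
      (Real.cos p.1 • fderiv ℝ g (Real.cos p.1 • x + Real.sin p.1 • p.2)).smulRight p.2)
    (bound := fun p => L * ‖p.2‖) univ_mem
    (Eventually.of_forall fun x => (integrable_mehlerField hg hL x).aestronglyMeasurable)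
    (integrable_mehlerField hg hL x) ?_
    (Eventually.of_forall fun p x _ => norm_fderiv_mehlerField_le hg hL x p)
    ((integrable_norm_snd a b).const_mul L) (Eventually.of_forall fun p x _ => ?_)
  · have h1 := continuous_fderiv_rotate hg hL x
    have : Continuous fun p : ℝ × F => (Real.cos p.1 •
        fderiv ℝ g (Real.cos p.1 • x + Real.sin p.1 • p.2)).smulRight p.2 :=
      ((ContinuousLinearMap.smulRightL ℝ F F).continuous.comp
        ((Real.continuous_cos.comp continuous_fst).smul h1)).clm_apply continuous_snd
    exact this.aestronglyMeasurable
  · have h1 : HasFDerivAt (fun x : F => Real.cos p.1 • x + Real.sin p.1 • p.2)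
        (Real.cos p.1 • ContinuousLinearMap.id ℝ F) x :=
      ((hasFDerivAt_id x).const_smul _).add_const _
    have h2 := ((hg.differentiable one_ne_zero _).hasFDerivAt.comp x h1).smul_const p.2
    refine h2.congr_fderiv ?_
    ext v
    simp

lemma contDiff_mehlerField : ContDiff ℝ 1 (mehlerField a b g) := by
  refine contDiff_one_iff_hasFDerivAt.2 ⟨_, ?_, hasFDerivAt_mehlerField hg hL⟩
  refine continuous_of_dominated (bound := fun p => L * ‖p.2‖) (fun x => ?_)
    (fun x => Eventually.of_forall fun p => norm_fderiv_mehlerField_le hg hL x p)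
    ((integrable_norm_snd a b).const_mul L) (Eventually.of_forall fun p => ?_)
  · have h1 := continuous_fderiv_rotate hg hL x
    have : Continuous fun p : ℝ × F => (Real.cos p.1 •
        fderiv ℝ g (Real.cos p.1 • x + Real.sin p.1 • p.2)).smulRight p.2 :=
      ((ContinuousLinearMap.smulRightL ℝ F F).continuous.comp
        ((Real.continuous_cos.comp continuous_fst).smul h1)).clm_apply continuous_snd
    exact this.aestronglyMeasurable
  · have h1 : Continuous fun x : F => fderiv ℝ g (Real.cos p.1 • x + Real.sin p.1 • p.2) :=
      (hg.continuous_fderiv one_ne_zero).comp (by fun_prop)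
    exact ((ContinuousLinearMap.smulRightL ℝ F F).continuous.comp
        (h1.const_smul (Real.cos p.1))).clm_apply continuous_const

lemma divergence_mehlerField (x : F) :
    divergence (mehlerField a b g) x =
      ∫ p, Real.cos p.1 * fderiv ℝ g (Real.cos p.1 • x + Real.sin p.1 • p.2) p.2
        ∂((volume : Measure ℝ).restrict (Ioc a b)).prod (stdGaussian F) := by
  rw [divergence_eq, (hasFDerivAt_mehlerField hg hL x).fderiv,
    ← ContinuousLinearMap.integral_comp_comm]
  · simp_rw [traceCLM_smulRight]
    rfl
  · refine ((integrable_norm_snd a b).const_mul L).mono' ?_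
      (Eventually.of_forall fun p => norm_fderiv_mehlerField_le hg hL x p)
    have h1 := continuous_fderiv_rotate hg hL x
    have : Continuous fun p : ℝ × F => (Real.cos p.1 •
        fderiv ℝ g (Real.cos p.1 • x + Real.sin p.1 • p.2)).smulRight p.2 :=
      ((ContinuousLinearMap.smulRightL ℝ F F).continuous.comp
        ((Real.continuous_cos.comp continuous_fst).smul h1)).clm_apply continuous_snd
    exact this.aestronglyMeasurable

lemma integrable_sin_mul_fderiv (x v : F) : Integrable (fun p : ℝ × F =>
      Real.sin p.1 * fderiv ℝ g (Real.cos p.1 • x + Real.sin p.1 • p.2) v)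
      (((volume : Measure ℝ).restrict (Ioc a b)).prod (stdGaussian F)) := by
  refine Integrable.of_bound (C := L * ‖v‖) ?_ (Eventually.of_forall fun p => ?_)
  · have : Continuous fun p : ℝ × F =>
        Real.sin p.1 * fderiv ℝ g (Real.cos p.1 • x + Real.sin p.1 • p.2) v :=
      (Real.continuous_sin.comp continuous_fst).mul
        ((continuous_fderiv_rotate hg hL x).clm_apply continuous_const)
    exact this.aestronglyMeasurable
  · rw [norm_mul]
    refine (mul_le_of_le_one_left (norm_nonneg _) (Real.abs_sin_le_one _)).trans ?_
    exact ((fderiv ℝ g _).le_opNorm v).trans (mul_le_mul_of_nonneg_right (hL _) (norm_nonneg _))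

lemma integrable_cos_mul_fderiv (x : F) : Integrable (fun p : ℝ × F =>
      Real.cos p.1 * fderiv ℝ g (Real.cos p.1 • x + Real.sin p.1 • p.2) p.2)
      (((volume : Measure ℝ).restrict (Ioc a b)).prod (stdGaussian F)) := by
  refine ((integrable_norm_snd a b).const_mul L).mono' ?_ (Eventually.of_forall fun p => ?_)
  · have : Continuous fun p : ℝ × F =>
        Real.cos p.1 * fderiv ℝ g (Real.cos p.1 • x + Real.sin p.1 • p.2) p.2 :=
      (Real.continuous_cos.comp continuous_fst).mul
        ((continuous_fderiv_rotate hg hL x).clm_apply continuous_snd)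
    exact this.aestronglyMeasurable
  · rw [norm_mul]
    refine (mul_le_of_le_one_left (norm_nonneg _) (Real.abs_cos_le_one _)).trans ?_
    exact ((fderiv ℝ g _).le_opNorm p.2).trans
      (mul_le_mul_of_nonneg_right (hL _) (norm_nonneg _))

variable {Ψ : F → ℝ} [(volume : Measure F).IsAddHaarMeasure]

/-- Stein's identity in `y`, at each fixed angle, trades the factor `y` of the field for a
derivative and produces the factor `sin t`. The field is thereby controlled by the Lipschitz
constant of `g` alone, with neither moments of `y` nor the size of `g`. -/
lemma inner_mehlerField (hΨ : IsGaussianDensity Ψ) (x v : F) :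
    inner ℝ v (mehlerField a b g x) =
      ∫ p, Real.sin p.1 * fderiv ℝ g (Real.cos p.1 • x + Real.sin p.1 • p.2) v
        ∂((volume : Measure ℝ).restrict (Ioc a b)).prod (stdGaussian F) := by
  have hi := integrable_mehlerField (a := a) (b := b) hg hL x
  have h1 := (innerSL ℝ v).integral_comp_comm hi
  simp only [innerSL_apply_apply, inner_smul_right] at h1
  rw [mehlerField, ← h1, integral_prod, integral_prod]
  · congr 1 with t
    have hk : ContDiff ℝ 1 fun y : F => g (Real.cos t • x + Real.sin t • y) :=
      hg.comp (contDiff_const.add (contDiff_const_smul _))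
    have hkd : ∀ y v : F, fderiv ℝ (fun y : F => g (Real.cos t • x + Real.sin t • y)) y v =
        Real.sin t * fderiv ℝ g (Real.cos t • x + Real.sin t • y) v := fun y v => by
      have h2 : HasFDerivAt (fun y : F => Real.cos t • x + Real.sin t • y)
          (Real.sin t • ContinuousLinearMap.id ℝ F) y :=
        ((hasFDerivAt_id y).const_smul _).const_add _
      have h3 := (hg.differentiable one_ne_zero _).hasFDerivAt.comp y h2
      have h4 := h3.fderiv
      simp only [Function.comp_def] at h4
      rw [h4]
      simp
    rw [hΨ.integral_mul_inner hk (C := |g 0| + L * ‖x‖) (L := L)]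
    · simp_rw [hkd]
    · intro y
      have hL0 : 0 ≤ L := (norm_nonneg _).trans (hL 0)
      have h3 := abs_le_of_norm_fderiv_le hg hL (Real.cos t • x + Real.sin t • y)
      have h4 := mul_le_mul_of_nonneg_left (norm_rotate_le x y t) hL0
      linarith
    · intro y
      have hL0 : 0 ≤ L := (norm_nonneg _).trans (hL 0)
      refine ContinuousLinearMap.opNorm_le_bound _ hL0 fun v => ?_
      rw [hkd, norm_mul]
      refine (mul_le_of_le_one_left (norm_nonneg _) (Real.abs_sin_le_one _)).trans ?_
      exact ((fderiv ℝ g _).le_opNorm v).trans (mul_le_mul_of_nonneg_right (hL _) (norm_nonneg _))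
  · exact integrable_sin_mul_fderiv hg hL x v
  · have h2 := (innerSL ℝ v).integrable_comp hi
    simpa only [innerSL_apply_apply, inner_smul_right] using h2

/-- Pair the value `v` of the field with itself: `‖v‖² ≤ L ‖v‖ ∫ sin t dt` over `[a, b]`, where
`sin` is nonnegative, and cancel one factor `‖v‖`. -/
lemma norm_mehlerField_le (hΨ : IsGaussianDensity Ψ) (hab : a ≤ b) (ha : 0 ≤ a)
    (hb : b ≤ Real.pi) (x : F) :
    ‖mehlerField a b g x‖ ≤ L * (Real.cos a - Real.cos b) := by
  have hL0 : 0 ≤ L := (norm_nonneg _).trans (hL 0)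
  set v := mehlerField a b g x
  have h1 : ‖v‖ ^ 2 ≤ L * ‖v‖ * (Real.cos a - Real.cos b) := by
    rw [← real_inner_self_eq_norm_sq, inner_mehlerField hg hL hΨ,
      integral_prod _ (integrable_sin_mul_fderiv hg hL x v)]
    have h2 : ∫ t in Ioc a b, L * ‖v‖ * Real.sin t = L * ‖v‖ * (Real.cos a - Real.cos b) := by
      rw [← intervalIntegral.integral_of_le hab, intervalIntegral.integral_const_mul, integral_sin]
    rw [← h2]
    refine setIntegral_mono_on ?_ ?_ measurableSet_Ioc fun t ht => ?_
    · exact (integrable_sin_mul_fderiv hg hL x v).integral_prod_left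
    · exact ((continuous_const.mul Real.continuous_sin).integrableOn_Icc).mono_set Ioc_subset_Icc_self
    · have hs : 0 ≤ Real.sin t := Real.sin_nonneg_of_nonneg_of_le_pi (ha.trans ht.1.le) (ht.2.trans hb)
      have h3 : ∀ y, Real.sin t * fderiv ℝ g (Real.cos t • x + Real.sin t • y) v ≤
          L * ‖v‖ * Real.sin t := fun y => by
        have h4 := (le_abs_self _).trans (((fderiv ℝ g
          (Real.cos t • x + Real.sin t • y)).le_opNorm v).trans
            (mul_le_mul_of_nonneg_right (hL _) (norm_nonneg v)))
        have := mul_le_mul_of_nonneg_left h4 hs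
        linarith
      have hcont : Continuous fun y : F =>
          Real.sin t * fderiv ℝ g (Real.cos t • x + Real.sin t • y) v :=
        continuous_const.mul (((hg.continuous_fderiv one_ne_zero).comp
          (by fun_prop)).clm_apply continuous_const)
      calc ∫ y, Real.sin t * fderiv ℝ g (Real.cos t • x + Real.sin t • y) v ∂stdGaussian F
          ≤ ∫ _, L * ‖v‖ * Real.sin t ∂stdGaussian F := by
            refine integral_mono ?_ (integrable_const _) h3
            refine Integrable.of_bound (C := L * ‖v‖) hcont.aestronglyMeasurable
              (Eventually.of_forall fun y => ?_)
            rw [norm_mul]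
            refine (mul_le_of_le_one_left (norm_nonneg _) (Real.abs_sin_le_one _)).trans ?_
            exact ((fderiv ℝ g _).le_opNorm v).trans
              (mul_le_mul_of_nonneg_right (hL _) (norm_nonneg _))
        _ = L * ‖v‖ * Real.sin t := by simp
  rcases (norm_nonneg v).eq_or_lt with h0 | h0
  · rw [← h0]
    exact mul_nonneg hL0 (sub_nonneg.2 (Real.cos_le_cos_of_nonneg_of_le_pi ha hb hab))
  · nlinarith

/-- The derivative of `t ↦ g(cos t x + sin t y)` is `cos t Dg(y) - sin t Dg(x)`. Its first term is
the integrand of the divergence, its second that of the inner product with `x`. Integrating first in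
`t` leaves the boundary values at `b` and `a`. -/
lemma divergence_mehlerField_sub (hΨ : IsGaussianDensity Ψ) (hab : a ≤ b) (x : F) :
    divergence (mehlerField a b g) x - inner ℝ x (mehlerField a b g x) =
      mehler b g x - mehler a g x := by
  have hi1 := integrable_cos_mul_fderiv (a := a) (b := b) hg hL x
  have hi2 := integrable_sin_mul_fderiv (a := a) (b := b) hg hL x x
  have hLip : ∀ t, Integrable (fun y => g (Real.cos t • x + Real.sin t • y)) (stdGaussian F) := by
    intro t
    have hL0 : 0 ≤ L := (norm_nonneg _).trans (hL 0)
    refine ((integrable_const (|g 0| + L * ‖x‖)).add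
      ((integrable_norm_stdGaussian (F := F)).const_mul L)).mono'
      (hg.continuous.comp (by fun_prop)).aestronglyMeasurable (Eventually.of_forall fun y => ?_)
    have h3 := abs_le_of_norm_fderiv_le hg hL (Real.cos t • x + Real.sin t • y)
    have h4 := mul_le_mul_of_nonneg_left (norm_rotate_le x y t) hL0
    simp only [Pi.add_apply, Real.norm_eq_abs]
    linarith
  have hi3 : Integrable (fun p : ℝ × F =>
      Real.cos p.1 * fderiv ℝ g (Real.cos p.1 • x + Real.sin p.1 • p.2) p.2 -
        Real.sin p.1 * fderiv ℝ g (Real.cos p.1 • x + Real.sin p.1 • p.2) x)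
      (((volume : Measure ℝ).restrict (Ioc a b)).prod (stdGaussian F)) := hi1.sub hi2
  rw [divergence_mehlerField hg hL, inner_mehlerField hg hL hΨ, ← integral_sub hi1 hi2,
    integral_prod_symm _ hi3, mehler, mehler, ← integral_sub (hLip b) (hLip a)]
  congr 1 with y
  rw [← intervalIntegral.integral_of_le hab]
  refine intervalIntegral.integral_eq_sub_of_hasDerivAt (f := fun t =>
    g (Real.cos t • x + Real.sin t • y)) (fun t _ => ?_) ?_
  · have h1 : HasDerivAt (fun t => Real.cos t • x + Real.sin t • y)
        (-Real.sin t • x + Real.cos t • y) t :=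
      ((Real.hasDerivAt_cos t).smul_const x).add ((Real.hasDerivAt_sin t).smul_const y)
    have h2 := (hg.differentiable one_ne_zero _).hasFDerivAt.comp_hasDerivAt t h1
    refine h2.congr_deriv ?_
    simp only [map_add, map_smul, smul_eq_mul]
    ring
  · have hc : Continuous fun t => fderiv ℝ g (Real.cos t • x + Real.sin t • y) :=
      (hg.continuous_fderiv one_ne_zero).comp (by fun_prop)
    exact ((Real.continuous_cos.mul (hc.clm_apply continuous_const)).sub
      (Real.continuous_sin.mul (hc.clm_apply continuous_const))).intervalIntegrable _ _

end

end MehlerField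

/-! ### The Gaussian isoperimetric inequality -/

section Isoperimetry

set_option linter.unusedSectionVars false

variable {F : Type*} [NormedAddCommGroup F] [InnerProductSpace ℝ F] [FiniteDimensional ℝ F]

/-! ### Lipschitz functions under the Ornstein-Uhlenbeck operators -/

section Lipschitz

variable [MeasurableSpace F] [BorelSpace F] {g : F → ℝ} {L : ℝ}

lemma continuous_of_abs_sub_le (hL : 0 ≤ L) (hg : ∀ x y, |g x - g y| ≤ L * ‖x - y‖) :
    Continuous g := by
  refine (LipschitzWith.of_dist_le_mul (K := ⟨L, hL⟩) fun x y => ?_).continuous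
  rw [Real.dist_eq, dist_eq_norm]
  exact hg x y

lemma abs_le_of_abs_sub_le (hg : ∀ x y, |g x - g y| ≤ L * ‖x - y‖) (x : F) :
    |g x| ≤ |g 0| + L * ‖x‖ := by
  have h1 := hg x 0
  rw [sub_zero] at h1
  have := abs_sub_abs_le_abs_sub (g x) (g 0)
  linarith

lemma integrable_of_abs_sub_le (hL : 0 ≤ L) (hg : ∀ x y, |g x - g y| ≤ L * ‖x - y‖) :
    Integrable g (stdGaussian F) :=
  ((integrable_const (|g 0|)).add (integrable_norm_stdGaussian.const_mul L)).mono'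
    (continuous_of_abs_sub_le hL hg).aestronglyMeasurable
    (Eventually.of_forall (abs_le_of_abs_sub_le hg))

lemma integrable_rotate_of_abs_sub_le (hL : 0 ≤ L) (hg : ∀ x y, |g x - g y| ≤ L * ‖x - y‖)
    (θ : ℝ) (x : F) :
    Integrable (fun y => g (Real.cos θ • x + Real.sin θ • y)) (stdGaussian F) := by
  refine integrable_of_abs_sub_le hL fun y z => (hg _ _).trans (mul_le_mul_of_nonneg_left ?_ hL)
  rw [add_sub_add_left_eq_sub, ← smul_sub, norm_smul]
  exact mul_le_of_le_one_left (norm_nonneg _) (Real.abs_sin_le_one θ)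

lemma abs_mehler_sub_mehler_le (hL : 0 ≤ L) (hg : ∀ x y, |g x - g y| ≤ L * ‖x - y‖) (θ : ℝ)
    (x y : F) : |mehler θ g x - mehler θ g y| ≤ L * ‖x - y‖ := by
  simp only [mehler]
  rw [← integral_sub (integrable_rotate_of_abs_sub_le hL hg θ x)
    (integrable_rotate_of_abs_sub_le hL hg θ y)]
  have h : ∀ z, ‖g (Real.cos θ • x + Real.sin θ • z) - g (Real.cos θ • y + Real.sin θ • z)‖ ≤
      L * ‖x - y‖ := fun z => by
    refine (hg _ _).trans (mul_le_mul_of_nonneg_left ?_ hL)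
    rw [add_sub_add_right_eq_sub, ← smul_sub, norm_smul]
    exact mul_le_of_le_one_left (norm_nonneg _) (Real.abs_cos_le_one θ)
  simpa using norm_integral_le_of_norm_le_const (μ := stdGaussian F) (Eventually.of_forall h)

lemma integrable_mehler_of_abs_sub_le (hL : 0 ≤ L) (hg : ∀ x y, |g x - g y| ≤ L * ‖x - y‖)
    (θ : ℝ) : Integrable (mehler θ g) (stdGaussian F) :=
  integrable_of_abs_sub_le hL (abs_mehler_sub_mehler_le hL hg θ)

end Lipschitz

variable [MeasureSpace F] [BorelSpace F] [(volume : Measure F).IsAddHaarMeasure]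

namespace IsGaussianDensity

variable {Ψ : F → ℝ} (hΨ : IsGaussianDensity Ψ)
include hΨ

/-- The perimeter controls the increments of the Ornstein-Uhlenbeck flow of Lipschitz functions. -/
lemma setIntegral_mehler_sub_le {E : Set F} (hE : MeasurableSet E)
    (hA : weightedPerimeter univ Ψ E ≠ ∞) {g : F → ℝ} {L : ℝ} (hL : 0 ≤ L)
    (hg : ∀ x y, |g x - g y| ≤ L * ‖x - y‖) {a b : ℝ} (ha : 0 ≤ a) (hab : a ≤ b)
    (hb : b ≤ Real.pi) :
    ∫ x in E, (mehler b g x - mehler a g x) ∂stdGaussian F ≤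
      L * (Real.cos a - Real.cos b) * (weightedPerimeter univ Ψ E).toReal := by
  set A := (weightedPerimeter univ Ψ E).toReal
  have hM : 0 ≤ L * (Real.cos a - Real.cos b) :=
    mul_nonneg hL (sub_nonneg.2 (Real.cos_le_cos_of_nonneg_of_le_pi ha hb hab))
  -- The field exists for a `C¹` function `k` within `ε` of `g`. Replacing `g` by `k` costs `ε` at
  -- each of the two angles, on a set of mass at most 1; a further `ε` in the bound on the field
  -- keeps it positive when `L (cos a - cos b) = 0`.
  have key : ∀ ε > 0, ∫ x in E, (mehler b g x - mehler a g x) ∂stdGaussian F ≤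
      L * (Real.cos a - Real.cos b) * A + ε * (A + 2) := by
    intro ε hε
    obtain ⟨k, hk, hkg, hkL⟩ := exists_contDiff_approx hL hg hε
    have hkl : ∀ x y, |k x - k y| ≤ L * ‖x - y‖ := fun x y =>
      convex_univ.norm_image_sub_le_of_norm_fderiv_le (𝕜 := ℝ) (f := k) (C := L)
        (fun x _ => hk.differentiable one_ne_zero x) (fun x _ => hkL x) (mem_univ y) (mem_univ x)
    have hclose : ∀ θ x, |mehler θ k x - mehler θ g x| ≤ ε := fun θ x => by
      simp only [mehler]
      rw [← integral_sub (integrable_rotate_of_abs_sub_le hL hkl θ x)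
        (integrable_rotate_of_abs_sub_le hL hg θ x)]
      have h : ∀ y, ‖k (Real.cos θ • x + Real.sin θ • y) -
          g (Real.cos θ • x + Real.sin θ • y)‖ ≤ ε := fun y => hkg _
      simpa using norm_integral_le_of_norm_le_const (μ := stdGaussian F) (Eventually.of_forall h)
    have hik := fun θ => integrable_mehler_of_abs_sub_le hL hkl θ
    have hig := fun θ => integrable_mehler_of_abs_sub_le hL hg θ
    have hfield := hΨ.setIntegral_le_perimeter hE hA (contDiff_mehlerField (a := a) (b := b) hk hkL)
      (M := L * (Real.cos a - Real.cos b) + ε) (by positivity)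
      (fun x => (norm_mehlerField_le hk hkL hΨ hab ha hb x).trans (by linarith)) (by
        simp_rw [divergence_mehlerField_sub hk hkL hΨ hab]
        exact (hik b).sub (hik a))
    simp_rw [divergence_mehlerField_sub hk hkL hΨ hab] at hfield
    have hcmp : ∫ x in E, (mehler b g x - mehler a g x) ∂stdGaussian F ≤
        ∫ x in E, ((mehler b k x - mehler a k x) + 2 * ε) ∂stdGaussian F := by
      refine integral_mono ((hig b).sub (hig a)).integrableOn
        (((hik b).sub (hik a)).add (integrable_const _)).integrableOn fun x => ?_
      have h1 := (abs_le.1 (hclose b x)).1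
      have h2 := (abs_le.1 (hclose a x)).2
      simp only
      linarith
    have hkk : IntegrableOn (fun x => mehler b k x - mehler a k x) E (stdGaussian F) :=
      ((hik b).sub (hik a)).integrableOn
    rw [integral_add hkk (integrable_const _)] at hcmp
    have h3 : ∫ _ in E, 2 * ε ∂stdGaussian F ≤ 2 * ε := by
      rw [setIntegral_const, smul_eq_mul]
      exact mul_le_of_le_one_left (by positivity) measureReal_le_one
    linarith
  refine le_of_forall_pos_le_add fun ε hε => ?_
  have hA0 : 0 ≤ A := ENNReal.toReal_nonneg
  have := key (ε / (A + 2)) (by positivity)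
  rwa [div_mul_cancel₀ _ (by positivity)] at this

/-! ### Growth of the integrated profile along the flow -/

section Flow

variable {E : Set F} (hE : MeasurableSet E) (hv : (stdGaussian F).real E ∈ Ioo (0 : ℝ) 1)
include hE hv

omit hΨ in
lemma integral_indicator_mem_Ioo :
    ∫ x, E.indicator (1 : F → ℝ) x ∂stdGaussian F ∈ Ioo (0 : ℝ) 1 := by
  rwa [integral_indicator_one hE]

lemma abs_quantile_mehler_sub_le {θ : ℝ} (hθ : 0 < θ) (hθ' : θ ≤ Real.pi / 2) (x y : F) :
    |gaussianQuantile (mehler θ (E.indicator 1) x) - gaussianQuantile (mehler θ (E.indicator 1) y)|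
      ≤ Real.cos θ / Real.sin θ * ‖x - y‖ := by
  have hf : Measurable (E.indicator (1 : F → ℝ)) := measurable_one.indicator hE
  have hf' : ∀ x, E.indicator (1 : F → ℝ) x ∈ Icc (0 : ℝ) 1 := fun x => by
    by_cases hx : x ∈ E <;> simp [hx]
  have hs : 0 < Real.sin θ := Real.sin_pos_of_pos_of_lt_pi hθ (by linarith [Real.pi_pos])
  have hc : 0 ≤ Real.cos θ := Real.cos_nonneg_of_neg_pi_div_two_le_of_le (by linarith) hθ'
  have h0 := integral_indicator_mem_Ioo hE hv
  have h1 := hΨ.quantile_mehler_le hf hf' h0 hs hc x y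
  have h2 := hΨ.quantile_mehler_le hf hf' h0 hs hc y x
  rw [norm_sub_rev] at h1
  exact abs_sub_le_iff.2 ⟨by linarith, by linarith⟩

/-- One step of the flow. The tangent to the concave profile at `P_a 1_E` has slope `-h_a`, so the
growth is at most `-∫ h_a (P_b 1_E - P_a 1_E)`. By symmetry this is the increment of the flow of
`-h_a` integrated over `E`, which the perimeter bounds because `h_a` is `cot a`-Lipschitz. -/
lemma integral_stdPDF_quantile_le (hA : weightedPerimeter univ Ψ E ≠ ∞) {a b : ℝ} (ha : 0 < a)
    (hab : a ≤ b) (hb : b ≤ Real.pi / 2) :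
    ∫ x, φ₁ (gaussianQuantile (mehler b (E.indicator 1) x)) ∂stdGaussian F ≤
      ∫ x, φ₁ (gaussianQuantile (mehler a (E.indicator 1) x)) ∂stdGaussian F +
        Real.cos a / Real.sin a * (Real.cos a - Real.cos b) *
          (weightedPerimeter univ Ψ E).toReal := by
  set f : F → ℝ := E.indicator 1
  have hf : Measurable f := measurable_one.indicator hE
  have hf' : ∀ x, f x ∈ Icc (0 : ℝ) 1 := fun x => by
    by_cases hx : x ∈ E <;> simp [f, hx]
  have hsin : ∀ θ, 0 < θ → θ ≤ Real.pi / 2 → 0 < Real.sin θ := fun θ h h' =>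
    Real.sin_pos_of_pos_of_lt_pi h (by linarith [Real.pi_pos])
  have h0 := integral_indicator_mem_Ioo hE hv
  have hL : 0 ≤ Real.cos a / Real.sin a :=
    div_nonneg (Real.cos_nonneg_of_neg_pi_div_two_le_of_le (by linarith) (hab.trans hb))
      (hsin a ha (hab.trans hb)).le
  set h : ℝ → F → ℝ := fun θ x => gaussianQuantile (mehler θ f x)
  have hΦ : ∀ θ, 0 < θ → θ ≤ Real.pi / 2 → ∀ x, Φ₁ (h θ x) = mehler θ f x := fun θ h h' x =>
    stdCDF_quantile (hΨ.mehler_mem_Ioo hf hf' h0 (hsin θ h h') x)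
  have hlip : ∀ x y, |h a x - h a y| ≤ Real.cos a / Real.sin a * ‖x - y‖ :=
    hΨ.abs_quantile_mehler_sub_le hE hv ha (hab.trans hb)
  have hcont : ∀ θ, 0 < θ → θ ≤ Real.pi / 2 → Continuous (h θ) := fun θ h1 h2 =>
    continuous_of_abs_sub_le (div_nonneg
      (Real.cos_nonneg_of_neg_pi_div_two_le_of_le (by linarith) h2) (hsin θ h1 h2).le)
      (hΨ.abs_quantile_mehler_sub_le hE hv h1 h2)
  have hint : ∀ θ, 0 < θ → θ ≤ Real.pi / 2 → Integrable (fun x => φ₁ (h θ x)) (stdGaussian F) :=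
    fun θ h1 h2 => Integrable.of_bound
      (continuous_stdPDF.comp (hcont θ h1 h2)).aestronglyMeasurable _
      (Eventually.of_forall fun x => by
        rw [Real.norm_of_nonneg (stdPDF_pos _).le]; exact stdPDF_le _)
  have hai := integrable_of_abs_sub_le hL hlip
  have ham := (hcont a ha (hab.trans hb)).measurable
  have hmi : ∀ θ, Integrable (fun x => h a x * mehler θ f x) (stdGaussian F) := fun θ =>
    hai.mul_bdd (c := 1) (measurable_mehler hf θ).aestronglyMeasurable
      (Eventually.of_forall fun x => by
        have := mehler_mem_Icc hf hf' θ x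
        rw [Real.norm_of_nonneg this.1]; exact this.2)
  -- Symmetry moves the operator from the indicator function to the Lipschitz function `h a`.
  have e1 : ∀ θ, ∫ x, h a x * mehler θ f x ∂stdGaussian F =
      ∫ x in E, mehler θ (h a) x ∂stdGaussian F := fun θ => by
    rw [integral_mul_mehler hf hf' ham hai, ← integral_indicator hE]
    congr 1 with x
    by_cases hx : x ∈ E <;> simp [f, hx]
  have hneg : ∀ θ x, mehler θ (fun x => -h a x) x = -mehler θ (h a) x := fun θ x =>
    integral_neg _
  have key := hΨ.setIntegral_mehler_sub_le hE hA (g := fun x => -h a x) hL (fun x y => by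
    rw [neg_sub_neg, abs_sub_comm]; exact hlip x y) ha.le hab (by linarith [Real.pi_pos])
  have hme := fun θ => (integrable_mehler_of_abs_sub_le hL hlip θ).integrableOn (s := E)
  simp_rw [hneg] at key
  have hmn : ∀ θ, IntegrableOn (fun x => -mehler θ (h a) x) E (stdGaussian F) := fun θ =>
    (hme θ).neg
  rw [integral_sub (hmn b) (hmn a), integral_neg, integral_neg, ← e1, ← e1] at key
  have hmono : ∫ x, φ₁ (h b x) ∂stdGaussian F ≤
      ∫ x, (φ₁ (h a x) - (h a x * mehler b f x - h a x * mehler a f x)) ∂stdGaussian F := by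
    refine integral_mono (hint b (ha.trans_le hab) hb)
      ((hint a ha (hab.trans hb)).sub ((hmi b).sub (hmi a))) fun x => ?_
    have := stdPDF_le_tangent (h b x) (h a x)
    rw [hΦ b (ha.trans_le hab) hb, hΦ a ha (hab.trans hb)] at this
    simp only
    linarith
  have hmm : Integrable (fun x => h a x * mehler b f x - h a x * mehler a f x) (stdGaussian F) :=
    (hmi b).sub (hmi a)
  rw [integral_sub (hint a ha (hab.trans hb)) hmm, integral_sub (hmi b) (hmi a)] at hmono
  simp only [h] at hmono key ⊢
  linarith

/-- A Riemann sum replaces differentiation in the angle. On each of `N + 1` equal steps the growth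
is `A` times a telescoping increment of `sin` plus an error quadratic in the step. The increments
sum to at most 1 and the errors to `O(1 / N)`, since `sin` stays above `sin δ`. -/
lemma integral_stdPDF_quantile_le_add (hA : weightedPerimeter univ Ψ E ≠ ∞) {δ : ℝ} (hδ : 0 < δ)
    (hδ' : δ ≤ Real.pi / 2) :
    ∫ x, φ₁ (gaussianQuantile (mehler (Real.pi / 2) (E.indicator 1) x)) ∂stdGaussian F ≤
      ∫ x, φ₁ (gaussianQuantile (mehler δ (E.indicator 1) x)) ∂stdGaussian F +
        (weightedPerimeter univ Ψ E).toReal := by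
  set A := (weightedPerimeter univ Ψ E).toReal
  have hA0 : 0 ≤ A := ENNReal.toReal_nonneg
  set J : ℝ → ℝ := fun θ => ∫ x, φ₁ (gaussianQuantile (mehler θ (E.indicator 1) x)) ∂stdGaussian F
  have hsδ : 0 < Real.sin δ := Real.sin_pos_of_pos_of_lt_pi hδ (by linarith [Real.pi_pos])
  have hstep : ∀ a b, δ ≤ a → a ≤ b → b ≤ Real.pi / 2 →
      J b ≤ J a + A * (Real.sin b - Real.sin a + (b - a) ^ 2 / (2 * Real.sin δ)) := by
    intro a b h1 h2 h3
    have ha := hδ.trans_le h1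
    have hsa : Real.sin δ ≤ Real.sin a :=
      Real.sin_le_sin_of_le_of_le_pi_div_two (by linarith [Real.pi_pos]) (h2.trans h3) h1
    have hsa' := hsδ.trans_le hsa
    refine (hΨ.integral_stdPDF_quantile_le hE hv hA ha h2 h3).trans ?_
    rw [mul_comm A]
    refine add_le_add le_rfl (mul_le_mul_of_nonneg_right ?_ hA0)
    -- The increment of `sin` is the main term, as `cot a · sin a = cos a`; the remainder is of
    -- second order in `b - a`.
    have e : Real.cos a / Real.sin a * (Real.cos a - Real.cos b) =
        Real.sin b - Real.sin a + (1 - Real.cos (b - a)) / Real.sin a := by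
      rw [Real.cos_sub]
      field_simp
      nlinarith [Real.sin_sq_add_cos_sq a]
    rw [e]
    refine add_le_add le_rfl ?_
    have h4 := Real.one_sub_sq_div_two_le_cos (x := b - a)
    calc (1 - Real.cos (b - a)) / Real.sin a ≤ ((b - a) ^ 2 / 2) / Real.sin a := by
          gcongr; linarith
      _ ≤ ((b - a) ^ 2 / 2) / Real.sin δ := by gcongr
      _ = (b - a) ^ 2 / (2 * Real.sin δ) := by rw [div_div]
  have hsum : ∀ w : ℝ, 0 ≤ w → ∀ i : ℕ, δ + i * w ≤ Real.pi / 2 →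
      J (δ + i * w) ≤ J δ + A * (Real.sin (δ + i * w) - Real.sin δ +
        i * (w ^ 2 / (2 * Real.sin δ))) := by
    intro w hw i
    induction i with
    | zero => simp
    | succ i ih =>
      intro hi
      push_cast at hi ⊢
      have hiw : 0 ≤ (i : ℝ) * w := by positivity
      have h1 := ih (by linarith)
      have h2 := hstep (δ + i * w) (δ + (i + 1) * w) (by linarith) (by linarith) hi
      have e : δ + (i + 1) * w - (δ + i * w) = w := by ring
      rw [e] at h2
      nlinarith
  have hN : ∀ N : ℕ, J (Real.pi / 2) ≤ J δ + A +
      A * ((Real.pi / 2 - δ) ^ 2 / (2 * Real.sin δ)) * (1 / ((N : ℝ) + 1)) := by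
    intro N
    have hN0 : (0 : ℝ) < N + 1 := by positivity
    have e : δ + ((N + 1 : ℕ) : ℝ) * ((Real.pi / 2 - δ) / (N + 1)) = Real.pi / 2 := by
      push_cast
      field_simp
      ring
    have h1 := hsum ((Real.pi / 2 - δ) / (N + 1)) (div_nonneg (by linarith) hN0.le) (N + 1) e.le
    rw [e, Real.sin_pi_div_two] at h1
    have e2 : ((N + 1 : ℕ) : ℝ) * (((Real.pi / 2 - δ) / (N + 1)) ^ 2 / (2 * Real.sin δ)) =
        ((Real.pi / 2 - δ) ^ 2 / (2 * Real.sin δ)) * (1 / ((N : ℝ) + 1)) := by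
      push_cast
      field_simp
    rw [e2] at h1
    -- The telescoped sum is `1 - sin δ`, and `A sin δ ≥ 0` is discarded.
    nlinarith [mul_nonneg hA0 hsδ.le]
  refine ge_of_tendsto' (f := fun N : ℕ => J δ + A +
      A * ((Real.pi / 2 - δ) ^ 2 / (2 * Real.sin δ)) * (1 / ((N : ℝ) + 1))) (x := atTop) ?_ hN
  simpa using (tendsto_one_div_add_atTop_nhds_zero_nat (𝕜 := ℝ)).const_mul
    (A * ((Real.pi / 2 - δ) ^ 2 / (2 * Real.sin δ))) |>.const_add (J δ + A)

end Flow

/-- **The Gaussian isoperimetric inequality.** -/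
theorem isoperimetric {E : Set F} (hE : MeasurableSet E)
    (hv : (stdGaussian F).real E ∈ Ioo (0 : ℝ) 1) :
    ENNReal.ofReal (φ₁ (gaussianQuantile ((stdGaussian F).real E))) ≤
      weightedPerimeter univ Ψ E := by
  by_cases hA : weightedPerimeter univ Ψ E = ∞
  · rw [hA]; exact le_top
  rw [ENNReal.ofReal_le_iff_le_toReal hA]
  set A := (weightedPerimeter univ Ψ E).toReal
  set f : F → ℝ := E.indicator 1
  have hf : Measurable f := measurable_one.indicator hE
  have hf' : ∀ x, f x ∈ Icc (0 : ℝ) 1 := fun x => by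
    by_cases hx : x ∈ E <;> simp [f, hx]
  have h0 := integral_indicator_mem_Ioo hE hv
  -- At the angle `π/2` the operator replaces a function by its mean.
  have hend : ∫ x, φ₁ (gaussianQuantile (mehler (Real.pi / 2) f x)) ∂stdGaussian F =
      φ₁ (gaussianQuantile ((stdGaussian F).real E)) := by
    have : ∀ x : F, mehler (Real.pi / 2) f x = (stdGaussian F).real E := fun x => by
      simp only [mehler, Real.cos_pi_div_two, Real.sin_pi_div_two, zero_smul, one_smul, zero_add]
      exact integral_indicator_one hE
    simp_rw [this]
    simp
  refine le_of_forall_pos_le_add fun ε hε => ?_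
  obtain ⟨K, hK, hKφ⟩ := exists_stdPDF_le hε
  -- For fixed `ε` let `δ → 0`: the `L¹` continuity of the flow removes the term with the constant
  -- `K`, which depends on `ε`.
  have hlim : Tendsto (fun δ => A + ε + K * ∫ x, |mehler δ f x - f x| ∂stdGaussian F) (𝓝[>] 0)
      (𝓝 (A + ε)) := by
    simpa using (((tendsto_integral_abs_mehler_sub hf hf').mono_left
      nhdsWithin_le_nhds).const_mul K).const_add (A + ε)
  refine ge_of_tendsto hlim ?_
  filter_upwards [Ioc_mem_nhdsGT (show (0 : ℝ) < Real.pi / 2 by positivity)] with δ hδ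
  rw [← hend]
  have hs : 0 < Real.sin δ := Real.sin_pos_of_pos_of_lt_pi hδ.1 (by linarith [Real.pi_pos, hδ.2])
  have hm := measurable_mehler hf δ
  have hu : ∀ x, mehler δ f x ∈ Ioo (0 : ℝ) 1 := hΨ.mehler_mem_Ioo hf hf' h0 hs
  have hi : Integrable (fun x => |mehler δ f x - f x|) (stdGaussian F) :=
    ((integrable_of_mem_Icc hm (mehler_mem_Icc hf hf' δ)).sub (integrable_of_mem_Icc hf hf')).abs
  have hJ : ∫ x, φ₁ (gaussianQuantile (mehler δ f x)) ∂stdGaussian F ≤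
      ∫ x, (ε + K * |mehler δ f x - f x|) ∂stdGaussian F := by
    refine integral_mono_of_nonneg (Eventually.of_forall fun x => (stdPDF_pos _).le)
      ((integrable_const _).add (hi.const_mul K)) (Eventually.of_forall fun x => ?_)
    refine (hKφ _).trans (add_le_add le_rfl (mul_le_mul_of_nonneg_left ?_ hK))
    rw [stdCDF_quantile (hu x)]
    have h1 := (hu x).1
    have h2 := (hu x).2
    -- As `f` is 0 or 1, `u (1 - u) ≤ |u - f|` for `u` in `(0, 1)`.
    by_cases hx : x ∈ E
    · have : f x = 1 := by simp [f, hx]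
      rw [this, abs_of_neg (by linarith)]
      nlinarith
    · have : f x = 0 := by simp [f, hx]
      rw [this, sub_zero, abs_of_pos h1]
      nlinarith
  rw [integral_add (integrable_const _) (hi.const_mul K), integral_const_mul] at hJ
  have := hΨ.integral_stdPDF_quantile_le_add hE hv hA hδ.1 hδ.2
  simp only [integral_const, probReal_univ, one_smul] at hJ
  linarith

end IsGaussianDensity

end Isoperimetry

/-! ### Perimeter of half-spaces -/

section HalfSpace

set_option linter.unusedSectionVars false

/-- The Gaussian means of the bumps `t ↦ r² φ(r² (s - t) + r)` converge to `φ(s)`. -/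
lemma tendsto_integral_stdPDF_bump (s : ℝ) :
    Tendsto (fun k : ℕ => ∫ t, ((k : ℝ) + 1) ^ 2 * φ₁ (((k : ℝ) + 1) ^ 2 * (s - t) + (k + 1))
      ∂gaussianReal 0 1) atTop (𝓝 (φ₁ s)) := by
  -- Substitute `w = r² (s - t) + r`, that is `t = s + 1/r - w/r²`, with `r = k + 1`. The bump
  -- becomes the fixed weight `φ(w)`, and the evaluation point tends to `s`.
  have e : ∀ k : ℕ, ∫ t, ((k : ℝ) + 1) ^ 2 * φ₁ (((k : ℝ) + 1) ^ 2 * (s - t) + (k + 1))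
      ∂gaussianReal 0 1 =
      ∫ w, φ₁ w * φ₁ (s + 1 / ((k : ℝ) + 1) - w * (1 / ((k : ℝ) + 1)) ^ 2) := by
    intro k
    set r : ℝ := (k : ℝ) + 1
    have hr : 0 < r := by positivity
    set g : ℝ → ℝ := fun w => φ₁ w * φ₁ (s + 1 / r - w * (1 / r) ^ 2)
    have h1 : ∫ t, g ((r ^ 2 * s + r) - r ^ 2 * t) = |(r ^ 2)⁻¹| • ∫ w, g w := by
      rw [Measure.integral_comp_mul_left (fun t => g ((r ^ 2 * s + r) - t)),
        integral_sub_left_eq_self]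
    have h2 : ∀ t, g ((r ^ 2 * s + r) - r ^ 2 * t) = φ₁ (r ^ 2 * (s - t) + r) * φ₁ t := fun t => by
      simp only [g]
      congr 2
      · ring
      · field_simp
        ring
    simp_rw [h2] at h1
    rw [integral_gaussianReal_eq_integral_smul one_ne_zero]
    have h3 : ∀ t, φ₁ t • (r ^ 2 * φ₁ (r ^ 2 * (s - t) + r)) =
        r ^ 2 * (φ₁ (r ^ 2 * (s - t) + r) * φ₁ t) := fun t => by
      rw [smul_eq_mul]; ring
    simp_rw [h3]
    rw [integral_const_mul, h1, abs_of_pos (by positivity), smul_eq_mul,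
      mul_inv_cancel_left₀ (by positivity)]
  simp_rw [e]
  have e2 : φ₁ s = ∫ w, φ₁ w * φ₁ s := by
    rw [integral_mul_const, integral_gaussianPDFReal_eq_one 0 one_ne_zero, one_mul]
  rw [e2]
  refine tendsto_integral_of_dominated_convergence (fun w => φ₁ w * (√(2 * Real.pi))⁻¹)
    (fun k => (continuous_stdPDF.mul (continuous_stdPDF.comp (by fun_prop))).aestronglyMeasurable)
    ((integrable_gaussianPDFReal 0 1).mul_const _) (fun k => Eventually.of_forall fun w => ?_)
    (Eventually.of_forall fun w => ?_)
  · rw [Real.norm_of_nonneg (mul_pos (stdPDF_pos _) (stdPDF_pos _)).le]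
    exact mul_le_mul_of_nonneg_left (stdPDF_le _) (stdPDF_pos _).le
  · refine ((continuous_stdPDF.tendsto s).comp ?_).const_mul _
    have h := tendsto_one_div_add_atTop_nhds_zero_nat (𝕜 := ℝ)
    simpa using (h.const_add s).sub ((h.pow 2).const_mul w)

variable {F : Type*} [NormedAddCommGroup F] [InnerProductSpace ℝ F] [FiniteDimensional ℝ F]

lemma contDiff_smul_of_mem_testFields {U : Set F} {X : F → F} (hX : X ∈ testFields U) {Ψ : F → ℝ}
    (hΨ : ContDiff ℝ 1 Ψ) : ContDiff ℝ 1 fun y => Ψ y • X y := hΨ.smul hX.1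

lemma hasCompactSupport_smul_of_mem_testFields {U : Set F} {X : F → F} (hX : X ∈ testFields U)
    (Ψ : F → ℝ) : HasCompactSupport fun y => Ψ y • X y := hX.2.1.smul_left (f := Ψ)

lemma divergence_eq_zero_of_notMem {X : F → F} {x : F} (hx : x ∉ tsupport X)
    (Ψ : F → ℝ) : divergence (fun y => Ψ y • X y) x = 0 := by
  have h : (fun y => Ψ y • X y) =ᶠ[𝓝 x] fun _ => 0 := by
    filter_upwards [notMem_tsupport_iff_eventuallyEq.1 hx] with y hy
    rw [hy]; simp
  rw [divergence_eq, h.fderiv_eq]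
  simp

variable [MeasureSpace F] [BorelSpace F] [(volume : Measure F).IsAddHaarMeasure]

lemma weightedPerimeter_empty (M : Set F) (Ψ : F → ℝ) : weightedPerimeter M Ψ ∅ = 0 := by
  simp [weightedPerimeter]

lemma weightedPerimeter_self (M : Set F) {Ψ : F → ℝ} (hΨ : ContDiff ℝ 1 Ψ) :
    weightedPerimeter M Ψ M = 0 := by
  refine le_antisymm (iSup₂_le fun X hX => ?_) zero_le
  rw [setIntegral_eq_integral_of_forall_compl_eq_zero fun x hx =>
    divergence_eq_zero_of_notMem (fun h => hx (interior_subset (hX.2.2.1 h))) Ψ,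
    integral_divergence_eq_zero (contDiff_smul_of_mem_testFields hX hΨ)
      (hasCompactSupport_smul_of_mem_testFields hX Ψ)]
  simp

/-- Replace the indicator function of the half-space by smooth functions `η_k` of `l`. The
divergence theorem turns `∫ η_k div(Ψ X)` into the integral of `β_k(l) l(X) Ψ`, where `l(X) ≤ 1`. As
`l` is standard Gaussian under the weighted measure, this is at most the Gaussian mean of `β_k`,
which tends to `φ(s)`. -/
lemma weightedPerimeter_halfSpace_le {M : Set F} {Ψ : F → ℝ}
    (hΨ : ContDiff ℝ 1 Ψ) (hΨ0 : ∀ x, 0 ≤ Ψ x) (l : F →L[ℝ] ℝ) (hl : ‖l‖ ≤ 1)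
    (hlaw : ((volume.restrict M).withDensity fun x => ENNReal.ofReal (Ψ x)).map l =
      gaussianReal 0 1) (s : ℝ) :
    weightedPerimeter M Ψ {x ∈ M | l x ≤ s} ≤ ENNReal.ofReal (φ₁ s) := by
  refine iSup₂_le fun X hX => ENNReal.ofReal_le_ofReal ?_
  set Y : F → F := fun y => Ψ y • X y
  have hY : ContDiff ℝ 1 Y := contDiff_smul_of_mem_testFields hX hΨ
  have hYs : HasCompactSupport Y := hasCompactSupport_smul_of_mem_testFields hX Ψ
  have hXM : ∀ x ∉ M, x ∉ tsupport X := fun x hx h => hx (interior_subset (hX.2.2.1 h))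
  have hH : MeasurableSet {x : F | l x ≤ s} := l.measurable measurableSet_Iic
  have hdi : Integrable (divergence Y) :=
    (continuous_divergence hY).integrable_of_hasCompactSupport (hasCompactSupport_divergence hYs)
  -- With `r = k + 1`, the shift by `r` makes `η_k → 1` on the hyperplane `l = s` as well, and the
  -- factor `r²` outweighs it where `l > s`. The convergence to the indicator function thus holds at
  -- every point.
  set η : ℕ → F → ℝ := fun k x => Φ₁ (((k : ℝ) + 1) ^ 2 * (s - l x) + (k + 1))
  set β : ℕ → ℝ → ℝ := fun k t =>
    ((k : ℝ) + 1) ^ 2 * φ₁ (((k : ℝ) + 1) ^ 2 * (s - t) + (k + 1))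
  have hηd : ∀ k x, HasFDerivAt (η k) (-(β k (l x)) • l) x := fun k x => by
    have h1 := ((((l.hasFDerivAt (x := x)).const_sub s).const_mul
      (((k : ℝ) + 1) ^ 2)).add_const ((k : ℝ) + 1))
    refine ((hasDerivAt_stdCDF _).comp_hasFDerivAt x h1).congr_fderiv ?_
    ext v
    simp [β]
    ring
  have hβc : ∀ k, Continuous (β k) := fun k =>
    continuous_const.mul (continuous_stdPDF.comp (by fun_prop))
  have hβ0 : ∀ k t, 0 ≤ β k t := fun k t => mul_nonneg (by positivity) (stdPDF_pos _).le
  have hηc : ∀ k, ContDiff ℝ 1 (η k) := fun k => by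
    refine contDiff_one_iff_hasFDerivAt.2 ⟨_, ?_, hηd k⟩
    exact (((hβc k).comp l.continuous).neg).smul continuous_const
  have hstep : ∀ k, ∫ x, η k x * divergence Y x ≤ ∫ t, β k t ∂gaussianReal 0 1 := by
    intro k
    have hz := integral_divergence_eq_zero ((hηc k).smul hY) (hYs.smul_left (f := η k))
    have hYd : ∀ x, DifferentiableAt ℝ Y x := hY.differentiable one_ne_zero
    have e1 : ∀ x, divergence (η k • Y) x = η k x * divergence Y x - β k (l x) * l (Y x) := by
      intro x
      rw [show divergence (η k • Y) x = _ from divergence_smul (hηd k x).differentiableAt (hYd x),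
        (hηd k x).fderiv]
      simp
      ring
    have i1 : Integrable fun x => η k x * divergence Y x :=
      ((hηc k).continuous.mul (continuous_divergence hY)).integrable_of_hasCompactSupport
        (hasCompactSupport_divergence hYs).mul_left
    have i2 : Integrable fun x => β k (l x) * l (Y x) :=
      (((hβc k).comp l.continuous).mul (l.continuous.comp hY.continuous)).integrable_of_hasCompactSupport
        (hYs.comp_left (g := l) (map_zero l)).mul_left
    have e2 : ∫ x, divergence (η k • Y) x = ∫ x, (η k x * divergence Y x - β k (l x) * l (Y x)) :=
      integral_congr_ae (Eventually.of_forall e1)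
    rw [e2, integral_sub i1 i2, sub_eq_zero] at hz
    rw [hz, ← hlaw, integral_map l.measurable.aemeasurable (hβc k).aestronglyMeasurable,
      integral_withDensity_eq_integral_toReal_smul hΨ.continuous.measurable.ennreal_ofReal
        (by simp)]
    simp_rw [ENNReal.toReal_ofReal (hΨ0 _)]
    rw [← setIntegral_eq_integral_of_forall_compl_eq_zero (s := M)]
    · have hfin : Integrable (fun t => β k t) (gaussianReal 0 1) :=
        Integrable.of_bound (hβc k).aestronglyMeasurable
          (((k : ℝ) + 1) ^ 2 * (√(2 * Real.pi))⁻¹) (Eventually.of_forall fun t => by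
            rw [Real.norm_of_nonneg (hβ0 k t)]
            exact mul_le_mul_of_nonneg_left (stdPDF_le _) (by positivity))
      rw [← hlaw, integrable_map_measure (hβc k).aestronglyMeasurable l.measurable.aemeasurable,
        integrable_withDensity_iff_integrable_smul' hΨ.continuous.measurable.ennreal_ofReal
          (by simp)] at hfin
      simp_rw [ENNReal.toReal_ofReal (hΨ0 _)] at hfin
      refine integral_mono i2.integrableOn hfin fun x => ?_
      have h1 : l (X x) ≤ 1 := (le_abs_self _).trans ((l.le_opNorm _).trans
        (mul_le_one₀ hl (norm_nonneg _) (hX.2.2.2 x)))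
      simp only [Y, map_smul, smul_eq_mul]
      have h2 := mul_nonneg (hβ0 k (l x)) (hΨ0 x)
      nlinarith
    · intro x hx
      have : X x = 0 := image_eq_zero_of_notMem_tsupport (hXM x hx)
      simp [Y, this]
  have e3 : ∫ x in {x ∈ M | l x ≤ s}, divergence Y x =
      ∫ x, {x : F | l x ≤ s}.indicator (divergence Y) x := by
    rw [integral_indicator hH]
    refine (setIntegral_eq_of_subset_of_forall_sdiff_eq_zero hH (fun x hx => hx.2)
      fun x hx => ?_).symm
    exact divergence_eq_zero_of_notMem (hXM x fun h => hx.2 ⟨h, hx.1⟩) Ψ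
  rw [e3]
  refine le_of_tendsto_of_tendsto' (tendsto_integral_of_dominated_convergence
    (F := fun k x => η k x * divergence Y x) (fun x => |divergence Y x|)
    (fun k => ((hηc k).continuous.mul (continuous_divergence hY)).aestronglyMeasurable)
    hdi.abs (fun k => Eventually.of_forall fun x => ?_) (Eventually.of_forall fun x => ?_))
    (tendsto_integral_stdPDF_bump s) hstep
  · rw [norm_mul, Real.norm_of_nonneg (cdf_nonneg _ _), Real.norm_eq_abs]
    exact mul_le_of_le_one_left (abs_nonneg _) (cdf_le_one _ _)
  · have hk : Tendsto (fun k : ℕ => (k : ℝ) + 1) atTop atTop :=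
      tendsto_atTop_add_const_right _ _ tendsto_natCast_atTop_atTop
    by_cases hx : l x ≤ s
    · have h1 : Tendsto (fun k : ℕ => ((k : ℝ) + 1) ^ 2 * (s - l x) + (k + 1)) atTop atTop :=
        tendsto_atTop_mono (fun k => le_add_of_nonneg_left
          (mul_nonneg (by positivity) (sub_nonneg.2 hx))) hk
      rw [indicator_of_mem (s := {x : F | l x ≤ s}) hx]
      simpa using ((tendsto_cdf_atTop (gaussianReal 0 1)).comp h1).mul_const (divergence Y x)
    · have hx' : s - l x < 0 := by linarith [not_le.1 hx]
      have h1 : Tendsto (fun k : ℕ => ((k : ℝ) + 1) * (((k : ℝ) + 1) * (s - l x) + 1)) atTop atBot :=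
        hk.atTop_mul_atBot₀ (tendsto_atBot_add_const_right _ _ (hk.atTop_mul_const_of_neg hx'))
      have h2 : Tendsto (fun k : ℕ => ((k : ℝ) + 1) ^ 2 * (s - l x) + (k + 1)) atTop atBot :=
        h1.congr fun k => by ring
      rw [indicator_of_notMem (s := {x : F | l x ≤ s}) hx]
      simpa using ((tendsto_cdf_atBot (gaussianReal 0 1)).comp h2).mul_const (divergence Y x)

end HalfSpace

/-! ### Profiles -/

section Profile

set_option linter.unusedSectionVars false

variable {F : Type*} [NormedAddCommGroup F] [InnerProductSpace ℝ F] [FiniteDimensional ℝ F]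
  [MeasureSpace F] [BorelSpace F] [(volume : Measure F).IsAddHaarMeasure]

lemma isoperimetricProfile_le {M : Set F} {μ : Measure F} {Ψ : F → ℝ} {v : ℝ} {E : Set F}
    (hE : MeasurableSet E) (hEM : E ⊆ M) (hv : μ E = ENNReal.ofReal v) :
    isoperimetricProfile M μ Ψ v ≤ weightedPerimeter M Ψ E :=
  iInf₂_le E ⟨hE, hEM, hv⟩

lemma isoperimetricProfile_zero (M : Set F) (μ : Measure F) (Ψ : F → ℝ) :
    isoperimetricProfile M μ Ψ 0 = 0 :=
  le_antisymm ((isoperimetricProfile_le MeasurableSet.empty (empty_subset M) (by simp)).trans_eq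
    (weightedPerimeter_empty M Ψ)) zero_le

lemma isoperimetricProfile_one {M : Set F} (hM : MeasurableSet M) {μ : Measure F} (hμ : μ M = 1)
    {Ψ : F → ℝ} (hΨ : ContDiff ℝ 1 Ψ) : isoperimetricProfile M μ Ψ 1 = 0 :=
  le_antisymm ((isoperimetricProfile_le hM subset_rfl (by simpa using hμ)).trans_eq
    (weightedPerimeter_self M hΨ)) zero_le

lemma isoperimetricProfile_eq {M : Set F} {μ : Measure F} {Ψ : F → ℝ} {v : ℝ} {c : ℝ≥0∞}
    {H : Set F} (hH : MeasurableSet H) (hHM : H ⊆ M) (hv : μ H = ENNReal.ofReal v)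
    (hle : weightedPerimeter M Ψ H ≤ c)
    (hge : ∀ E, MeasurableSet E → E ⊆ M → μ E = ENNReal.ofReal v → c ≤ weightedPerimeter M Ψ E) :
    isoperimetricProfile M μ Ψ v = c ∧ IsIsoperimetricMinimizer M μ Ψ v H := by
  have h1 : isoperimetricProfile M μ Ψ v = c :=
    le_antisymm ((isoperimetricProfile_le hH hHM hv).trans hle)
      (le_iInf₂ fun E hE => hge E hE.1 hE.2.1 hE.2.2)
  exact ⟨h1, hH, hHM, hv, by rw [h1]; exact le_antisymm hle (hge H hH hHM hv)⟩

end Profile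

/-! ### The line -/

section Line

lemma stdGaussian_real : stdGaussian ℝ = gaussianReal 0 1 := by
  have h := stdGaussian_map_inner (F := ℝ) (e := 1) (by simp)
  simpa using h

lemma isGaussianDensity_real : IsGaussianDensity (F := ℝ) φ₁ where
  stdGaussian_eq := by
    rw [stdGaussian_real, gaussianReal_of_var_ne_zero _ one_ne_zero]
    rfl
  exists_eq_exp := ⟨(√(2 * Real.pi))⁻¹, by positivity, fun x => by
    rw [stdPDF_eq, Real.norm_eq_abs, sq_abs]⟩

lemma gaussianReal_Iic_quantile {v : ℝ} (hv : v ∈ Ioo (0 : ℝ) 1) :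
    gaussianReal 0 1 (Iic (gaussianQuantile v)) = ENNReal.ofReal v := by
  rw [← ofReal_cdf, stdCDF_quantile hv]

theorem gaussianProfile_eq {v : ℝ} (hv : v ∈ Ioo (0 : ℝ) 1) :
    gaussianProfile v = ENNReal.ofReal (φ₁ (gaussianQuantile v)) := by
  refine (isoperimetricProfile_eq (H := Iic (gaussianQuantile v)) measurableSet_Iic
    (subset_univ _) (gaussianReal_Iic_quantile hv) ?_ fun E hE _ hEv => ?_).1
  · have h := weightedPerimeter_halfSpace_le (M := (univ : Set ℝ)) (Ψ := φ₁) contDiff_stdPDF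
      (fun x => (stdPDF_pos x).le) (ContinuousLinearMap.id ℝ ℝ) (by simp) (by
        rw [Measure.restrict_univ, ← isGaussianDensity_real.stdGaussian_eq, stdGaussian_real]
        exact Measure.map_id) (gaussianQuantile v)
    have e : {x ∈ (univ : Set ℝ) | ContinuousLinearMap.id ℝ ℝ x ≤ gaussianQuantile v} =
        Iic (gaussianQuantile v) := by
      ext; simp
    rwa [e] at h
  · have hr : (stdGaussian ℝ).real E = v := by
      rw [stdGaussian_real, Measure.real, hEv, ENNReal.toReal_ofReal hv.1.le]
    have h := isGaussianDensity_real.isoperimetric hE (hr ▸ hv)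
    rwa [hr] at h

lemma gaussianProfile_zero : gaussianProfile 0 = 0 := isoperimetricProfile_zero _ _ _

lemma gaussianProfile_one : gaussianProfile 1 = 0 :=
  isoperimetricProfile_one MeasurableSet.univ measure_univ contDiff_stdPDF

end Line

/-! ### The slab as an image of Gauss space -/

section Slab

variable {m : ℕ} {T : ℝ}

/-- The product density of the standard Gaussian measure. -/
def prodDensity (n : ℕ) (x : EuclideanSpace ℝ (Fin n)) : ℝ := ∏ i, φ₁ (x i)

lemma isGaussianDensity_prodDensity (n : ℕ) : IsGaussianDensity (prodDensity n) where
  stdGaussian_eq := by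
    have hs : SigmaFinite ((volume : Measure ℝ).withDensity (gaussianPDF 0 1)) := by
        rw [← gaussianReal_of_var_ne_zero _ one_ne_zero]; infer_instance
    have h := pi_withDensity_eq n (fun _ => gaussianPDF 0 1) fun _ => measurable_gaussianPDF 0 1
    rw [← gaussianReal_of_var_ne_zero _ one_ne_zero] at h
    have hvol := PiLp.volume_preserving_toLp (Fin n)
    have hemb : MeasurableEmbedding (WithLp.toLp 2 : (Fin n → ℝ) → _) :=
      (MeasurableEquiv.toLp 2 (Fin n → ℝ)).measurableEmbedding
    rw [← map_pi_eq_stdGaussian, h]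
    ext s hs
    rw [Measure.map_apply (by fun_prop) hs, withDensity_apply _ hs,
      withDensity_apply _ ((WithLp.measurable_toLp 2 _) hs),
      ← hvol.setLIntegral_comp_preimage_emb hemb]
    refine setLIntegral_congr_fun ((WithLp.measurable_toLp 2 _) hs) fun x _ => ?_
    simp only [prodDensity, gaussianPDF]
    rw [ENNReal.ofReal_prod_of_nonneg fun i _ => gaussianPDFReal_nonneg 0 1 _]
  exists_eq_exp := ⟨((√(2 * Real.pi))⁻¹) ^ n, by positivity, fun x => by
    simp only [prodDensity, stdPDF_eq]
    rw [Finset.prod_mul_distrib, Finset.prod_const, Finset.card_univ, Fintype.card_fin,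
      ← Real.exp_sum, EuclideanSpace.norm_sq_eq, ← Finset.sum_div, Finset.sum_neg_distrib]
    simp⟩

/-- The contraction of Gauss space onto the interior of the slab. -/
def slabMap (m : ℕ) (T : ℝ) (x : EuclideanSpace ℝ (Fin (m + 1))) : EuclideanSpace ℝ (Fin (m + 1)) :=
  WithLp.toLp 2 (Fin.cons (T * Φ₁ (x 0)) fun i => x i.succ)

@[simp] lemma slabMap_zero (x : EuclideanSpace ℝ (Fin (m + 1))) :
    slabMap m T x 0 = T * Φ₁ (x 0) := rfl

@[simp] lemma slabMap_succ (x : EuclideanSpace ℝ (Fin (m + 1))) (i : Fin m) :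
    slabMap m T x i.succ = x i.succ := rfl

lemma continuous_slabMap : Continuous (slabMap m T) := by
  refine (PiLp.continuous_toLp 2 _).comp (continuous_pi fun i => ?_)
  refine Fin.cases ?_ (fun j => ?_) i
  · simp only [Fin.cons_zero]
    exact continuous_const.mul (continuous_stdCDF.comp (by fun_prop))
  · simp only [Fin.cons_succ]
    fun_prop

lemma slabMap_mem (hT : 0 < T) (x : EuclideanSpace ℝ (Fin (m + 1))) :
    slabMap m T x 0 ∈ Ioo 0 T := by
  rw [slabMap_zero]
  exact ⟨mul_pos hT (stdCDF_pos _), by nlinarith [stdCDF_lt_one (x 0)]⟩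

/-- The probability integral transform: `Φ` of a standard Gaussian variable is uniform. It suffices
to compare the two finite measures on the half-lines `Iic a`, for `a ≤ 0`, `a ≥ T` and `a` in
between. -/
lemma map_mul_stdCDF (hT : 0 < T) : (gaussianReal 0 1).map (fun s => T * Φ₁ s) =
    (ENNReal.ofReal T)⁻¹ • (volume : Measure ℝ).restrict (Icc 0 T) := by
  have hm : Measurable fun s => T * Φ₁ s := (continuous_const.mul continuous_stdCDF).measurable
  have hTne : (ENNReal.ofReal T)⁻¹ ≠ ∞ := by simp [hT]
  have : IsFiniteMeasure ((ENNReal.ofReal T)⁻¹ • (volume : Measure ℝ).restrict (Icc 0 T)) :=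
    Measure.smul_finite _ hTne
  have hIcc : ∀ a, a ≤ T → (ENNReal.ofReal T)⁻¹ * volume (Iic a ∩ Icc 0 T) =
      ENNReal.ofReal (a / T) := fun a ha => by
    have : Iic a ∩ Icc 0 T = Icc 0 a := by
      ext x; simp only [mem_inter_iff, mem_Iic, mem_Icc]
      exact ⟨fun h => ⟨h.2.1, h.1⟩, fun h => ⟨h.2, h.1, h.2.trans ha⟩⟩
    rw [this, Real.volume_Icc, sub_zero, ENNReal.ofReal_div_of_pos hT, ENNReal.div_eq_inv_mul]
  refine Measure.ext_of_Iic _ _ fun a => ?_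
  rw [Measure.map_apply hm measurableSet_Iic, Measure.smul_apply,
    Measure.restrict_apply measurableSet_Iic, smul_eq_mul]
  rcases le_or_gt a 0 with h0 | h0
  · rw [hIcc a (h0.trans hT.le), ENNReal.ofReal_of_nonpos (div_nonpos_of_nonpos_of_nonneg h0 hT.le)]
    convert measure_empty (μ := gaussianReal 0 1)
    ext s
    simp only [mem_preimage, mem_Iic, mem_empty_iff_false, iff_false, not_le]
    exact h0.trans_lt (mul_pos hT (stdCDF_pos s))
  rcases le_or_gt T a with h1 | h1
  · have e1 : Iic a ∩ Icc 0 T = Iic T ∩ Icc 0 T := by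
      rw [inter_eq_right.2, inter_eq_right.2] <;> intro x hx
      · exact hx.2
      · exact hx.2.trans h1
    rw [e1, hIcc T le_rfl, div_self hT.ne', ENNReal.ofReal_one]
    convert measure_univ (μ := gaussianReal 0 1)
    ext s
    simp only [mem_preimage, mem_Iic, mem_univ, iff_true]
    nlinarith [stdCDF_lt_one s]
  · have hv : a / T ∈ Ioo (0 : ℝ) 1 := ⟨div_pos h0 hT, (div_lt_one hT).2 h1⟩
    rw [hIcc a h1.le, ← gaussianReal_Iic_quantile hv]
    congr 1
    ext s
    simp only [mem_preimage, mem_Iic]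
    rw [← strictMono_stdCDF.le_iff_le (a := s), stdCDF_quantile hv, le_div_iff₀ hT, mul_comm]

lemma map_slabMap (hT : 0 < T) :
    (stdGaussian (EuclideanSpace ℝ (Fin (m + 1)))).map (slabMap m T) = slabMeasure m T := by
  have hm : Measurable fun s => T * Φ₁ s := (continuous_const.mul continuous_stdCDF).measurable
  have hcons : ∀ {α : Type} [MeasurableSpace α] {f : α → ℝ} {g : α → Fin m → ℝ}, Measurable f →
      Measurable g → Measurable fun p =>
        WithLp.toLp 2 (Fin.cons (f p) (fun i => g p i) : Fin (m + 1) → ℝ) := by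
    intro α _ f g hf hg
    refine (WithLp.measurable_toLp 2 _).comp (measurable_pi_lambda _ fun i => ?_)
    refine Fin.cases ?_ (fun j => ?_) i
    · simpa using hf
    · simp only [Fin.cons_succ]
      exact (measurable_pi_apply j).comp hg
  have h1 := (measurePreserving_piFinSuccAbove (fun _ : Fin (m + 1) => gaussianReal 0 1) 0).symm.map_eq
  have hS : Measurable fun p : ℝ × EuclideanSpace ℝ (Fin m) =>
      WithLp.toLp 2 (Fin.cons p.1 (fun i => p.2 i) : Fin (m + 1) → ℝ) :=
    hcons measurable_fst (by fun_prop)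
  rw [slabMeasure, ← map_mul_stdCDF hT, ← map_pi_eq_stdGaussian, ← map_pi_eq_stdGaussian,
    Measure.map_prod_map _ _ hm (by fun_prop), Measure.map_map hS (by fun_prop), ← h1,
    Measure.map_map (by fun_prop) (MeasurableEquiv.measurable _),
    Measure.map_map continuous_slabMap.measurable (by fun_prop)]
  congr 1

lemma isOpen_openSlab : IsOpen {x : EuclideanSpace ℝ (Fin (m + 1)) | x 0 ∈ Ioo 0 T} := by
  have : Continuous fun x : EuclideanSpace ℝ (Fin (m + 1)) => x 0 := by fun_prop
  exact isOpen_Ioo.preimage this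

lemma openSlab_subset_interior :
    {x : EuclideanSpace ℝ (Fin (m + 1)) | x 0 ∈ Ioo 0 T} ⊆ interior (slab m T) :=
  interior_maximal (fun _ hx => Ioo_subset_Icc_self hx) isOpen_openSlab

lemma measurableSet_slab : MeasurableSet (slab m T) := by
  have : Measurable fun x : EuclideanSpace ℝ (Fin (m + 1)) => x 0 := by fun_prop
  exact this measurableSet_Icc

lemma contDiff_slabDensity : ContDiff ℝ 1 (slabDensity m T) := by
  refine contDiff_const.mul (contDiff_prod fun i _ => contDiff_stdPDF.comp ?_)
  fun_prop

lemma slabDensity_pos (hT : 0 < T) (x : EuclideanSpace ℝ (Fin (m + 1))) : 0 < slabDensity m T x :=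
  mul_pos (inv_pos.2 hT) (Finset.prod_pos fun _ _ => stdPDF_pos _)

/-- The density does not depend on `x 0`, so only the Gaussian coordinates contribute. -/
lemma fderiv_slabDensity (x v : EuclideanSpace ℝ (Fin (m + 1))) :
    fderiv ℝ (slabDensity m T) x v = -(slabDensity m T x * ∑ i : Fin m, x i.succ * v i.succ) := by
  have e : slabDensity m T = fun x : EuclideanSpace ℝ (Fin (m + 1)) =>
      (T⁻¹ * (√(2 * Real.pi))⁻¹ ^ m) * Real.exp (∑ i : Fin m, -(x i.succ ^ 2) / 2) := by
    funext x
    simp only [slabDensity, stdPDF_eq]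
    rw [Finset.prod_mul_distrib, Finset.prod_const, Finset.card_univ, Fintype.card_fin,
      ← Real.exp_sum, mul_assoc]
  have h1 : HasFDerivAt (fun x : EuclideanSpace ℝ (Fin (m + 1)) => ∑ i : Fin m, -(x i.succ ^ 2) / 2)
      (∑ i : Fin m, (-(x i.succ)) • (EuclideanSpace.proj i.succ : EuclideanSpace ℝ (Fin (m + 1)) →L[ℝ] ℝ)) x := by
    refine HasFDerivAt.fun_sum fun i _ => ?_
    have h2 := (EuclideanSpace.proj i.succ : EuclideanSpace ℝ (Fin (m + 1)) →L[ℝ] ℝ).hasFDerivAt (x := x)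
    have h3 : HasDerivAt (fun t : ℝ => -(t ^ 2) / 2) (-(x i.succ)) (x i.succ) := by
      refine ((((hasDerivAt_id (x i.succ)).fun_pow 2).fun_neg).div_const 2).congr_deriv ?_
      simp
      ring
    exact h3.comp_hasFDerivAt x h2
  have h4 := (h1.exp.const_mul (T⁻¹ * (√(2 * Real.pi))⁻¹ ^ m)).fderiv
  rw [← e] at h4
  rw [h4, e]
  simp [Finset.mul_sum, mul_assoc]

/-- The weighted divergence on the slab. -/
lemma divergence_slabDensity_smul
    {X : EuclideanSpace ℝ (Fin (m + 1)) → EuclideanSpace ℝ (Fin (m + 1))}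
    {x : EuclideanSpace ℝ (Fin (m + 1))} (hX : DifferentiableAt ℝ X x) :
    divergence (fun y => slabDensity m T y • X y) x =
      slabDensity m T x * (divergence X x - ∑ i : Fin m, x i.succ * X x i.succ) := by
  rw [divergence_smul (contDiff_slabDensity.differentiable one_ne_zero x) hX, fderiv_slabDensity]
  ring

lemma slabMeasure_slab (hT : 0 < T) : slabMeasure m T (slab m T) = 1 := by
  rw [← map_slabMap hT, Measure.map_apply continuous_slabMap.measurable measurableSet_slab]
  convert measure_univ (μ := stdGaussian (EuclideanSpace ℝ (Fin (m + 1))))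
  ext x
  simp only [mem_preimage, mem_univ, iff_true]
  exact Ioo_subset_Icc_self (slabMap_mem hT x)

lemma slabMeasure_map_last (hm : 1 ≤ m) (hT : 0 < T) :
    (slabMeasure m T).map (EuclideanSpace.proj (Fin.last m) :
      EuclideanSpace ℝ (Fin (m + 1)) →L[ℝ] ℝ) =
      gaussianReal 0 1 := by
  rw [← map_slabMap hT, Measure.map_map (ContinuousLinearMap.measurable _)
    continuous_slabMap.measurable,
    ← stdGaussian_map_inner (e := EuclideanSpace.single (Fin.last m) (1 : ℝ)) (by simp)]
  congr 1
  funext x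
  -- Because `m ≥ 1`, the last coordinate differs from the bounded one and is fixed by `slabMap`.
  obtain ⟨k, rfl⟩ : ∃ k, m = k + 1 := ⟨m - 1, by omega⟩
  rw [EuclideanSpace.inner_single_left]
  simp [← Fin.succ_last]

end Slab

/-! ### Transport of fields and comparison of perimeters -/

section Transport

variable {m : ℕ} {T : ℝ}

local notation "𝔼" => EuclideanSpace ℝ (Fin (m + 1))

/-- The inverse of `slabMap` on the open slab. -/
def slabInv (m : ℕ) (T : ℝ) (y : EuclideanSpace ℝ (Fin (m + 1))) : EuclideanSpace ℝ (Fin (m + 1)) :=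
  y + (gaussianQuantile (y 0 / T) - y 0) • EuclideanSpace.single 0 (1 : ℝ)

lemma slabInv_zero (y : 𝔼) : slabInv m T y 0 = gaussianQuantile (y 0 / T) := by
  simp [slabInv]

lemma slabInv_succ (y : 𝔼) (i : Fin m) : slabInv m T y i.succ = y i.succ := by
  simp [slabInv]

lemma slabInv_slabMap (hT : 0 < T) (x : 𝔼) : slabInv m T (slabMap m T x) = x := by
  ext i
  refine Fin.cases ?_ (fun j => ?_) i
  · rw [slabInv_zero, slabMap_zero, mul_div_cancel_left₀ _ hT.ne', quantile_stdCDF]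
  · rw [slabInv_succ, slabMap_succ]

lemma div_mem_Ioo (hT : 0 < T) {t : ℝ} (ht : t ∈ Ioo 0 T) : t / T ∈ Ioo (0 : ℝ) 1 :=
  ⟨div_pos ht.1 hT, (div_lt_one hT).2 ht.2⟩

lemma slabMap_slabInv (hT : 0 < T) {y : 𝔼} (hy : y 0 ∈ Ioo 0 T) :
    slabMap m T (slabInv m T y) = y := by
  ext i
  refine Fin.cases ?_ (fun j => ?_) i
  · rw [slabMap_zero, slabInv_zero, stdCDF_quantile (div_mem_Ioo hT hy), mul_div_cancel₀ _ hT.ne']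
  · rw [slabMap_succ, slabInv_succ]

/-- The push-forward of a field under `slabMap`, extended by zero. -/
def pushField (T : ℝ) (X : 𝔼 → 𝔼) (y : 𝔼) : 𝔼 :=
  open Classical in
  if y 0 ∈ Ioo 0 T then
    X (slabInv m T y) + ((T * φ₁ (gaussianQuantile (y 0 / T)) - 1) * X (slabInv m T y) 0) •
      EuclideanSpace.single 0 (1 : ℝ)
  else 0

lemma pushField_zero {X : 𝔼 → 𝔼} {y : 𝔼} (hy : y 0 ∈ Ioo 0 T) :
    pushField T X y 0 = T * φ₁ (gaussianQuantile (y 0 / T)) * X (slabInv m T y) 0 := by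
  simp only [pushField, if_pos hy]
  simp
  ring

lemma pushField_succ {X : 𝔼 → 𝔼} {y : 𝔼} (hy : y 0 ∈ Ioo 0 T) (i : Fin m) :
    pushField T X y i.succ = X (slabInv m T y) i.succ := by
  simp only [pushField, if_pos hy]
  simp

/-- The bound on the width enters here: the maximum of `φ` is `1 / √(2π)`, and `T φ` is the
derivative of `T Φ`. -/
lemma mul_stdPDF_le_one (hT' : T ≤ √(2 * Real.pi)) (s : ℝ) : T * φ₁ s ≤ 1 := by
  calc T * φ₁ s ≤ √(2 * Real.pi) * (√(2 * Real.pi))⁻¹ :=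
        mul_le_mul hT' (stdPDF_le s) (stdPDF_pos s).le (by positivity)
    _ = 1 := mul_inv_cancel₀ (by positivity)

/-- The differential of `slabMap` scales component 0 by `T φ ≤ 1` and fixes the other components. -/
lemma norm_pushField_le (hT : 0 < T) (hT' : T ≤ √(2 * Real.pi)) {X : 𝔼 → 𝔼}
    (hX : ∀ x, ‖X x‖ ≤ 1) (y : 𝔼) : ‖pushField T X y‖ ≤ 1 := by
  by_cases hy : y 0 ∈ Ioo 0 T
  · refine le_trans ?_ (hX (slabInv m T y))
    rw [EuclideanSpace.norm_eq, EuclideanSpace.norm_eq]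
    refine Real.sqrt_le_sqrt (Finset.sum_le_sum fun i _ => ?_)
    refine pow_le_pow_left₀ (norm_nonneg _) ?_ 2
    refine Fin.cases ?_ (fun j => ?_) i
    · rw [pushField_zero hy, norm_mul, Real.norm_of_nonneg (mul_pos hT (stdPDF_pos _)).le]
      exact mul_le_of_le_one_left (norm_nonneg _) (mul_stdPDF_le_one hT' _)
    · rw [pushField_succ hy]
  · rw [pushField, if_neg hy]
    simp

lemma pushField_eq_zero (hT : 0 < T) {X : 𝔼 → 𝔼} {y : 𝔼} (hy : y ∉ slabMap m T '' tsupport X) :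
    pushField T X y = 0 := by
  by_cases h : y 0 ∈ Ioo 0 T
  · have : X (slabInv m T y) = 0 := image_eq_zero_of_notMem_tsupport fun h' =>
      hy ⟨_, h', slabMap_slabInv hT h⟩
    simp [pushField, this]
  · rw [pushField, if_neg h]

/-- Inside the open slab the field is a composition of `C¹` maps. The image of the compact support
is closed and contained in the open slab, so near any other point the field is zero, although the
inverse map is singular at the boundary. -/
lemma contDiff_pushField (hT : 0 < T) {X : 𝔼 → 𝔼} (hX : ContDiff ℝ 1 X)
    (hXs : HasCompactSupport X) : ContDiff ℝ 1 (pushField T X) := by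
  refine contDiff_iff_contDiffAt.2 fun y => ?_
  by_cases h : y 0 ∈ Ioo 0 T
  · have hq : ContDiffAt ℝ 1 (fun y : 𝔼 => gaussianQuantile (y 0 / T)) y := by
      have h1 : ContDiffAt ℝ 1 gaussianQuantile (y 0 / T) :=
        contDiffOn_quantile.contDiffAt (isOpen_Ioo.mem_nhds (div_mem_Ioo hT h))
      have h2 : ContDiff ℝ 1 fun y : 𝔼 => y 0 / T := by fun_prop
      exact h1.comp y h2.contDiffAt
    have hp : ContDiff ℝ 1 fun y : 𝔼 => y 0 := by fun_prop
    have hi : ContDiffAt ℝ 1 (slabInv m T) y :=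
      contDiffAt_id.add ((hq.sub hp.contDiffAt).smul contDiffAt_const)
    have hXi : ContDiffAt ℝ 1 (fun y => X (slabInv m T y)) y := hX.contDiffAt.comp y hi
    have hXi0 : ContDiffAt ℝ 1 (fun y => X (slabInv m T y) 0) y := hp.contDiffAt.comp y hXi
    have hb : ContDiffAt ℝ 1 (fun y : 𝔼 => T * φ₁ (gaussianQuantile (y 0 / T)) - 1) y :=
      (contDiffAt_const.mul (contDiff_stdPDF.contDiffAt.comp y hq)).sub contDiffAt_const
    refine (hXi.add ((hb.mul hXi0).smul (contDiffAt_const (c := EuclideanSpace.single 0 (1 : ℝ))))).congr_of_eventuallyEq ?_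
    filter_upwards [isOpen_openSlab.mem_nhds h] with z hz
    exact if_pos hz
  · have hK : IsClosed (slabMap m T '' tsupport X) := (hXs.image continuous_slabMap).isClosed
    have hy : y ∉ slabMap m T '' tsupport X := by
      rintro ⟨x, -, rfl⟩
      exact h (slabMap_mem hT x)
    refine (contDiffAt_const (c := (0 : 𝔼))).congr_of_eventuallyEq ?_
    filter_upwards [hK.isOpen_compl.mem_nhds hy] with z hz using pushField_eq_zero hT hz

lemma pushField_mem_testFields (hT : 0 < T) (hT' : T ≤ √(2 * Real.pi)) {X : 𝔼 → 𝔼}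
    (hX : X ∈ testFields (interior (univ : Set 𝔼))) :
    pushField T X ∈ testFields (interior (slab m T)) := by
  have hK : IsCompact (slabMap m T '' tsupport X) := hX.2.1.image continuous_slabMap
  refine ⟨contDiff_pushField hT hX.1 hX.2.1,
    HasCompactSupport.intro hK fun y hy => pushField_eq_zero hT hy, ?_,
    norm_pushField_le hT hT' hX.2.2.2⟩
  refine (closure_minimal (fun y hy => ?_) hK.isClosed).trans
    (show slabMap m T '' tsupport X ⊆ _ from ?_)
  · by_contra h
    exact hy (pushField_eq_zero hT h)
  · rintro _ ⟨x, -, rfl⟩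
    exact openSlab_subset_interior (slabMap_mem hT x)

lemma traceCLM_eq_sum_apply {n : ℕ}
    (L : EuclideanSpace ℝ (Fin n) →L[ℝ] EuclideanSpace ℝ (Fin n)) :
    traceCLM L = ∑ i, L (EuclideanSpace.single i (1 : ℝ)) i := by
  rw [traceCLM_eq_sum (EuclideanSpace.basisFun (Fin n) ℝ)]
  refine Finset.sum_congr rfl fun i _ => ?_
  rw [EuclideanSpace.basisFun_apply, EuclideanSpace.inner_single_left]
  simp

/-- The weighted divergence is invariant under the push-forward of fields. -/
lemma divergence_pushField_slabMap (hT : 0 < T) {X : 𝔼 → 𝔼} (hX : ContDiff ℝ 1 X) (x : 𝔼) :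
    divergence (pushField T X) (slabMap m T x) -
      ∑ i : Fin m, slabMap m T x i.succ * pushField T X (slabMap m T x) i.succ =
      divergence X x - inner ℝ x (X x) := by
  set y := slabMap m T x
  have hy : y 0 ∈ Ioo 0 T := slabMap_mem hT x
  have hQy : slabInv m T y = x := slabInv_slabMap hT x
  set e₀ : 𝔼 := EuclideanSpace.single 0 (1 : ℝ)
  set p : 𝔼 →L[ℝ] ℝ := EuclideanSpace.proj 0
  have hqy : gaussianQuantile (y 0 / T) = x 0 := by rw [← slabInv_zero, hQy]
  set b := T * φ₁ (x 0)
  have hb : b ≠ 0 := (mul_pos hT (stdPDF_pos _)).ne'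
  have hq : HasFDerivAt (fun z : 𝔼 => gaussianQuantile (z 0 / T)) (b⁻¹ • p) y := by
    have h1 := hasDerivAt_quantile (div_mem_Ioo hT hy)
    have h2 : HasFDerivAt (fun z : 𝔼 => z 0 / T) (T⁻¹ • p) y :=
      ((p.hasFDerivAt (x := y)).const_mul T⁻¹).congr_of_eventuallyEq
        (Eventually.of_forall fun z => div_eq_inv_mul _ _)
    refine (h1.comp_hasFDerivAt y h2).congr_fderiv ?_
    rw [hqy, smul_smul, ← mul_inv, mul_comm]
  have hQ : HasFDerivAt (slabInv m T)
      (ContinuousLinearMap.id ℝ 𝔼 + (b⁻¹ • p - p).smulRight e₀) y :=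
    (hasFDerivAt_id y).add ((hq.sub p.hasFDerivAt).smul_const e₀)
  have hXQ : HasFDerivAt (fun z => X (slabInv m T z)) ((fderiv ℝ X x).comp
      (ContinuousLinearMap.id ℝ 𝔼 + (b⁻¹ • p - p).smulRight e₀)) y := by
    have h := (hX.differentiable one_ne_zero (slabInv m T y)).hasFDerivAt.comp y hQ
    rwa [hQy] at h
  -- The profile `φ ∘ Φ⁻¹` has derivative `-Φ⁻¹`, and the factors `T` and `1/T` cancel. The
  -- resulting `-x 0` supplies the drift term in direction 0 that the divergence of the slab lacks.
  have hbd : HasFDerivAt (fun z : 𝔼 => T * φ₁ (gaussianQuantile (z 0 / T)) - 1)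
      ((-x 0) • p) y := by
    have h := (((hasDerivAt_stdPDF (gaussianQuantile (y 0 / T))).comp_hasFDerivAt y hq).const_mul
      T).sub_const 1
    refine h.congr_fderiv ?_
    rw [hqy, smul_smul, smul_smul]
    congr 1
    have hφ := (stdPDF_pos (x 0)).ne'
    simp only [b]
    field_simp
  have hmain := hXQ.add ((hbd.mul (p.hasFDerivAt.comp y hXQ)).smul_const e₀)
  have hpush : HasFDerivAt (pushField T X) _ y := hmain.congr_of_eventuallyEq (by
    filter_upwards [isOpen_openSlab.mem_nhds hy] with z hz
    exact if_pos hz)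
  have hval : ∀ v, fderiv ℝ (pushField T X) y v =
      fderiv ℝ X x (v + (b⁻¹ * p v - p v) • e₀) +
        ((b - 1) * fderiv ℝ X x (v + (b⁻¹ * p v - p v) • e₀) 0 + X x 0 * (-x 0 * p v)) • e₀ := by
    intro v
    rw [hpush.fderiv, hqy]
    simp only [Function.comp_apply, hQy]
    rfl
  have hps : ∀ i : Fin m, p (EuclideanSpace.single i.succ (1 : ℝ)) = 0 := fun i => by simp [p]
  have hp0 : p e₀ = 1 := by simp [p, e₀]
  have hes : ∀ i : Fin m, e₀ i.succ = 0 := fun i => by simp [e₀]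
  have he0 : e₀ 0 = 1 := by simp [e₀]
  have hsucc : ∀ i : Fin m, fderiv ℝ (pushField T X) y (EuclideanSpace.single i.succ 1) i.succ =
      fderiv ℝ X x (EuclideanSpace.single i.succ 1) i.succ := fun i => by
    rw [hval, hps]
    simp [hes]
  -- The factor `b⁻¹` from differentiating the inverse map cancels the stretching factor `b` of
  -- component 0.
  have hzero : fderiv ℝ (pushField T X) y e₀ 0 = fderiv ℝ X x e₀ 0 - x 0 * X x 0 := by
    have : e₀ + (b⁻¹ - 1) • e₀ = b⁻¹ • e₀ := by module
    rw [hval, hp0, mul_one, this, map_smul]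
    simp only [PiLp.add_apply, PiLp.smul_apply, he0, smul_eq_mul]
    field_simp
    ring
  have h1 : ∀ i : Fin m, y i.succ * pushField T X y i.succ = x i.succ * X x i.succ := fun i => by
    rw [pushField_succ hy, hQy]
    rfl
  rw [divergence_eq, divergence_eq, traceCLM_eq_sum_apply, traceCLM_eq_sum_apply,
    Fin.sum_univ_succ, Fin.sum_univ_succ, PiLp.inner_apply, Fin.sum_univ_succ, hzero]
  simp_rw [hsucc, h1, real_inner_eq_re_inner, RCLike.inner_apply]
  simp [mul_comm]
  ring

/-- The slab is a contraction of Gauss space: its perimeter is at least the Gaussian one. -/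
lemma weightedPerimeter_preimage_le (hT : 0 < T) (hT' : T ≤ √(2 * Real.pi)) {E : Set 𝔼}
    (hE : MeasurableSet E) (hES : E ⊆ slab m T) :
    weightedPerimeter univ (prodDensity (m + 1)) (slabMap m T ⁻¹' E) ≤
      weightedPerimeter (slab m T) (slabDensity m T) E := by
  refine iSup₂_le fun X hX => ?_
  have hP := pushField_mem_testFields hT hT' hX
  refine le_iSup₂_of_le (pushField T X) hP (ENNReal.ofReal_le_ofReal (le_of_eq ?_))
  have hΨ := isGaussianDensity_prodDensity (m + 1)
  have hE' : MeasurableSet (slabMap m T ⁻¹' E) := continuous_slabMap.measurable hE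
  set k : 𝔼 → ℝ := fun y =>
    divergence (pushField T X) y - ∑ i : Fin m, y i.succ * pushField T X y i.succ
  have hk : Continuous k := by
    have h1 := hP.1.continuous
    exact (continuous_divergence hP.1).sub (by fun_prop)
  calc ∫ x in slabMap m T ⁻¹' E, divergence (fun y => prodDensity (m + 1) y • X y) x
      = ∫ x in slabMap m T ⁻¹' E, (divergence X x - inner ℝ x (X x)) ∂stdGaussian 𝔼 := by
        rw [hΨ.setIntegral_eq _ hE']
        exact integral_congr_ae (Eventually.of_forall fun x =>
          hΨ.divergence_smul (hX.1.differentiable one_ne_zero x))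
    _ = ∫ x in slabMap m T ⁻¹' E, k (slabMap m T x) ∂stdGaussian 𝔼 :=
        integral_congr_ae (Eventually.of_forall fun x =>
          (divergence_pushField_slabMap hT hX.1 x).symm)
    _ = ∫ y in E, k y ∂slabMeasure m T := by
        rw [← map_slabMap hT, setIntegral_map hE hk.aestronglyMeasurable
          continuous_slabMap.aemeasurable]
    _ = ∫ y in E, slabDensity m T y * k y := by
        rw [slabMeasure_eq_withDensity m hT, restrict_withDensity hE,
          Measure.restrict_restrict_of_subset hES, integral_withDensity_eq_integral_toReal_smul
            contDiff_slabDensity.continuous.measurable.ennreal_ofReal (by simp)]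
        simp_rw [ENNReal.toReal_ofReal (slabDensity_pos hT _).le, smul_eq_mul]
    _ = ∫ y in E, divergence (fun z => slabDensity m T z • pushField T X z) y :=
        integral_congr_ae (Eventually.of_forall fun y =>
          (divergence_slabDensity_smul (hP.1.differentiable one_ne_zero y)).symm)

end Transport

/-! ### The isoperimetric profile of the slab -/

section Main

variable {m : ℕ} {T : ℝ}

lemma slabMeasure_horizontalHalfSpace (hm : 1 ≤ m) (hT : 0 < T) (s : ℝ) :
    slabMeasure m T (horizontalHalfSpace m T s) = gaussianReal 0 1 (Iic s) := by
  have hl := (EuclideanSpace.proj (Fin.last m) :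
      EuclideanSpace ℝ (Fin (m + 1)) →L[ℝ] ℝ).measurable
  have hfin : IsProbabilityMeasure (slabMeasure m T) := by
    rw [← map_slabMap hT]
    exact Measure.isProbabilityMeasure_map continuous_slabMap.aemeasurable
  rw [← slabMeasure_map_last hm hT, Measure.map_apply hl measurableSet_Iic,
    ← measure_inter_conull (s := EuclideanSpace.proj (Fin.last m) ⁻¹' Iic s) ((prob_compl_eq_zero_iff measurableSet_slab).2 (slabMeasure_slab hT)),
    inter_comm]
  rfl

/-- The half-space bound is applied to the last coordinate, which has norm at most 1 as a functional
and is standard Gaussian on the slab. A competitor is compared with its preimage under `slabMap`, of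
the same volume and of no larger perimeter. -/
theorem isoperimetricProfile_slab (hm : 1 ≤ m) (hT : 0 < T) (hT' : T ≤ √(2 * Real.pi)) {v : ℝ}
    (hv : v ∈ Ioo (0 : ℝ) 1) :
    isoperimetricProfile (slab m T) (slabMeasure m T) (slabDensity m T) v =
        ENNReal.ofReal (φ₁ (gaussianQuantile v)) ∧
      IsIsoperimetricMinimizer (slab m T) (slabMeasure m T) (slabDensity m T) v
        (horizontalHalfSpace m T (gaussianQuantile v)) := by
  have hl := (EuclideanSpace.proj (Fin.last m) :
      EuclideanSpace ℝ (Fin (m + 1)) →L[ℝ] ℝ).measurable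
  refine isoperimetricProfile_eq (measurableSet_slab.inter (hl measurableSet_Iic))
    (fun x hx => hx.1) ?_ ?_ fun E hE hES hEv => ?_
  · rw [slabMeasure_horizontalHalfSpace hm hT, gaussianReal_Iic_quantile hv]
  · refine weightedPerimeter_halfSpace_le contDiff_slabDensity (fun x => (slabDensity_pos hT x).le)
      (EuclideanSpace.proj (Fin.last m)) ?_ ?_ _
    · refine ContinuousLinearMap.opNorm_le_bound _ zero_le_one fun x => ?_
      rw [one_mul]
      exact PiLp.norm_apply_le x _
    · rw [← slabMeasure_eq_withDensity m hT, slabMeasure_map_last hm hT]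
  · refine le_trans ?_ (weightedPerimeter_preimage_le hT hT' hE hES)
    have hE' : MeasurableSet (slabMap m T ⁻¹' E) := continuous_slabMap.measurable hE
    have hr : (stdGaussian (EuclideanSpace ℝ (Fin (m + 1)))).real (slabMap m T ⁻¹' E) = v := by
      rw [Measure.real, ← Measure.map_apply continuous_slabMap.measurable hE, map_slabMap hT, hEv,
        ENNReal.toReal_ofReal hv.1.le]
    have h := (isGaussianDensity_prodDensity (m + 1)).isoperimetric hE' (hr ▸ hv)
    rwa [hr] at h

end Main

end GaussianSlab

end

theorem mainTheorem8 (m : ℕ) (hm : 1 ≤ m) (T : ℝ) (hT : 0 < T) (hT' : T ≤ √(2 * Real.pi)) :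
    (∀ v ∈ Set.Icc (0 : ℝ) 1,
      GaussianSlab.isoperimetricProfile (GaussianSlab.slab m T) (GaussianSlab.slabMeasure m T)
        (GaussianSlab.slabDensity m T) v = GaussianSlab.gaussianProfile v) ∧
    (∀ v ∈ Set.Ioo (0 : ℝ) 1,
      GaussianSlab.IsIsoperimetricMinimizer (GaussianSlab.slab m T) (GaussianSlab.slabMeasure m T)
        (GaussianSlab.slabDensity m T) v
        (GaussianSlab.horizontalHalfSpace m T (GaussianSlab.gaussianQuantile v)) ∧
      GaussianSlab.gaussianProfile v = ENNReal.ofReal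
        (ProbabilityTheory.gaussianPDFReal 0 1 (GaussianSlab.gaussianQuantile v))) := by
  refine ⟨fun v hv => ?_, fun v hv => ⟨(GaussianSlab.isoperimetricProfile_slab hm hT hT' hv).2,
    GaussianSlab.gaussianProfile_eq hv⟩⟩
  -- At volumes 0 and 1 the quantile is meaningless; both profiles vanish there, by the empty set
  -- and the whole domain.
  rcases hv.1.eq_or_lt with rfl | h0
  · rw [GaussianSlab.gaussianProfile_zero, GaussianSlab.isoperimetricProfile_zero]
  rcases hv.2.eq_or_lt with rfl | h1
  · rw [GaussianSlab.gaussianProfile_one, GaussianSlab.isoperimetricProfile_one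
      GaussianSlab.measurableSet_slab (GaussianSlab.slabMeasure_slab hT)
      GaussianSlab.contDiff_slabDensity]
  · rw [GaussianSlab.gaussianProfile_eq ⟨h0, h1⟩,
      (GaussianSlab.isoperimetricProfile_slab hm hT hT' ⟨h0, h1⟩).1]
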